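/- All theories are first-order theories with equality in the language $\{\in\}$. Consider the following axioms, where the objects are called classes: - Extensionality: $\forall X\,\forall Y\,(\forall Z(Z\in X\Leftrightarrow Z\in Y)\Rightarrow X=Y)$. - Foundation: $\forall A\,[\exists X(X\in A)\Rightarrow\exists Y\in A\,\neg\exists Z\in A\,(Z\in Y)]$. - Pairing: $\forall A\,\forall B\,\exists X\,\forall Y\,(Y\in X\Leftrightarrow Y=A\lor Y=B)$. - Union: $\forall A\,\exists X\,\forall Y\,(Y\in X\Leftrightarrow\exists Z\in A\,(Y\in Z))$. - Power: $\forall A\,\exists X\,\forall Y\,(Y\in X\Leftrightarrow\forall Z\in Y\,(Z\in A))$. - Infinity: there is a class $N$ that has an empty element and is such that for every $n\in N$ there is $m\in N$ with $\forall y\,(y\in m\Leftrightarrow y\in n\lor y=n)$. - Replacement*: for every formula $\varphi(X,Z)$ with no free variables other than $X,Z$, $$\forall A\,\exists B\,\forall Y\,\bigl[Y\in B\Leftrightarrow\exists X\in A\,\forall Z\,(Z\in Y\Leftrightarrow\varphi(X,Z))\bigr].$$ Let $\mathrm{ZF}^*$ be the theory with these axioms, and let $\mathrm{ZF}$ be the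 usual theory: Extensionality, Foundation, Pairing, Union, Power, Infinity, and the schemes of Separation and Replacement with parameters. Define $x=^*y$ ($x,y$ are co-extensional) as $\forall z(z\in x\Leftrightarrow z\in y)$. Call $y$ a *set* if $\forall m\,\forall n\,(m=^*n\Rightarrow(m\in y\Leftrightarrow n\in y))$, and define $x\in^*y$ as: $y$ is a set and $x\in y$. A transitive closure of $x$ is a least transitive class $t$ with $x\subseteq t$ (least with respect to $\subseteq$, where inclusion and transitivity are with respect to $\in$). Call $x$ a *pure set* if $x$ is a set and has a transitive closure all of whose elements are sets. In the language of set theory, call $F$ a *hierarchy-building function* if $F$ is a function (a set of Kuratowski pairs) whose domain is an ordinal (a transitive set of transitive sets on which $\in$ is well-founded), $F(0)=\emptyset$, $F(\alpha+1)$ is the power set of $F(\alpha)$, and $F(\lambda)=\bigcup_{\alpha<\lambda}F(\alpha)$ for limit $\lambda$, wherever these are in the domain. Say that $x$ *lies in a cumulative hierarchy* if $x\in F(\alpha)$ for some such $F$ and some $\alpha$ in its domain. For a domain formula $\delta(x)$, translate a formula by replacing $=$ by $=^*$ and $\in$ by $\in^*$, and by restricting all quantifiers to objects that satisfy $\delta$.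 This translation interprets a theory $S$ in a theory $T$ if the translation of every theorem of $S$ is a theorem of $T$. Then: 1. With $\delta(x)$ = "$x$ is a pure set", the translation interprets $\mathrm{ZF}$ in $\mathrm{ZF}^*$ without Extensionality. 2. With $\delta(x)$ = "$x$ is a pure set that lies in a cumulative hierarchy", where "lies in a cumulative hierarchy" is itself evaluated in the pure sets (that is, translated with the domain of part 1), the translation interprets $\mathrm{ZF}$ in $\mathrm{ZF}^*$ without Extensionality and without Foundation. -/

import Mathlib

open FirstOrder

namespace SetInterp

/-- The only nonlogical symbol of the language of set theory: a binary relation symbol. -/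
inductive MemRel : ℕ → Type
  | mem : MemRel 2

/-- The first-order language of set theory (equality is a logical symbol). -/
def LSet : FirstOrder.Language.{0, 0} := ⟨fun _ => Empty, MemRel⟩

/-- The atomic formula `s ∈ t`. -/
def memF {α : Type} {n : ℕ} (s t : LSet.Term (α ⊕ Fin n)) : LSet.BoundedFormula α n :=
  Language.Relations.boundedFormula₂ (L := LSet) MemRel.mem s t

infix:88 " ∈ₛ " => memF

/-- The free variable `i`, as a term. (Bound variables are written `&0, &1, …`, the outermost
quantifier binding `&0`.) -/
def fv {α : Type} {n : ℕ} (i : α) : LSet.Term (α ⊕ Fin n) := Language.Term.var (Sum.inl i)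

/-- The formula `φ` with the terms `ts` put for its free variables. -/
def app {α β : Type} {n : ℕ} (φ : LSet.Formula β) (ts : β → LSet.Term (α ⊕ Fin n)) :
    LSet.BoundedFormula α n :=
  Language.BoundedFormula.relabel (k := 0) (id : α ⊕ Fin n → α ⊕ Fin n)
    (Language.BoundedFormula.subst (n := 0) φ ts)

/-- The universal closure of a formula. -/
def close {n : ℕ} (φ : LSet.Formula (Fin n)) : LSet.Sentence :=
  Language.BoundedFormula.alls (n := n)
    (Language.BoundedFormula.relabel (k := 0) (Sum.inr : Fin n → Empty ⊕ Fin n) φ)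

/-! ### The axioms -/

/-- `∀ X Y, (∀ Z, Z ∈ X ↔ Z ∈ Y) → X = Y` -/
def extensionality : LSet.Sentence :=
  ∀' ∀' ((∀' ((&2 ∈ₛ &0) ⇔ (&2 ∈ₛ &1))) ⟹ (&0 =' &1))

/-- `∀ A, (∃ X, X ∈ A) → ∃ Y ∈ A, ¬ ∃ Z ∈ A, Z ∈ Y` -/
def foundation : LSet.Sentence :=
  ∀' ((∃' (&1 ∈ₛ &0)) ⟹ ∃' ((&1 ∈ₛ &0) ⊓ ∼(∃' ((&2 ∈ₛ &0) ⊓ (&2 ∈ₛ &1)))))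

/-- `∀ A B, ∃ X, ∀ Y, Y ∈ X ↔ Y = A ∨ Y = B` -/
def pairing : LSet.Sentence :=
  ∀' ∀' ∃' ∀' ((&3 ∈ₛ &2) ⇔ ((&3 =' &0) ⊔ (&3 =' &1)))

/-- `∀ A, ∃ X, ∀ Y, Y ∈ X ↔ ∃ Z ∈ A, Y ∈ Z` -/
def union : LSet.Sentence :=
  ∀' ∃' ∀' ((&2 ∈ₛ &1) ⇔ ∃' ((&3 ∈ₛ &0) ⊓ (&2 ∈ₛ &3)))

/-- `∀ A, ∃ X, ∀ Y, Y ∈ X ↔ ∀ Z ∈ Y, Z ∈ A` -/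
def power : LSet.Sentence :=
  ∀' ∃' ∀' ((&2 ∈ₛ &1) ⇔ ∀' ((&3 ∈ₛ &2) ⟹ (&3 ∈ₛ &0)))

/-- `∃ N, (∃ E ∈ N, ∀ Z, Z ∉ E) ∧ ∀ X ∈ N, ∃ M ∈ N, ∀ Y, Y ∈ M ↔ Y ∈ X ∨ Y = X` -/
def infinity : LSet.Sentence :=
  ∃' ((∃' ((&1 ∈ₛ &0) ⊓ ∀' ∼(&2 ∈ₛ &1))) ⊓
    ∀' ((&1 ∈ₛ &0) ⟹
      ∃' ((&2 ∈ₛ &0) ⊓ ∀' ((&3 ∈ₛ &2) ⇔ ((&3 ∈ₛ &1) ⊔ (&3 =' &1))))))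

/-- Replacement*, for a formula `φ(X, Z)` without further free variables:
`∀ A, ∃ B, ∀ Y, Y ∈ B ↔ ∃ X ∈ A, ∀ Z, Z ∈ Y ↔ φ(X, Z)`. -/
def replacementStar (φ : LSet.Formula (Fin 2)) : LSet.Sentence :=
  ∀' ∃' ∀' ((&2 ∈ₛ &1) ⇔
    ∃' ((&3 ∈ₛ &0) ⊓ ∀' ((&4 ∈ₛ &2) ⇔ app φ ![&3, &4])))

/-- Separation, for a formula `φ(p, y)` with parameters `p`: the universal closure of
`∀ A, ∃ x, ∀ y, y ∈ x ↔ y ∈ A ∧ φ(p, y)`. -/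
def separation {n : ℕ} (φ : LSet.Formula (Fin n ⊕ Fin 1)) : LSet.Sentence :=
  close (n := n) (∀' ∃' ∀' ((&2 ∈ₛ &1) ⇔ ((&2 ∈ₛ &0) ⊓ app φ (Sum.elim fv ![&2]))))

/-- The usual axiom of Replacement, for a formula `φ(p, x, y)` with parameters `p`: the
universal closure of
`∀ A, (∀ x ∈ A, ∃ k, ∀ y, φ(p, x, y) ↔ y = k) → ∃ B, ∀ y, y ∈ B ↔ ∃ x ∈ A, φ(p, x, y)`. -/
def replacement {n : ℕ} (φ : LSet.Formula (Fin n ⊕ Fin 2)) : LSet.Sentence :=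
  close (n := n) (∀'
    ((∀' ((&1 ∈ₛ &0) ⟹ ∃' ∀' (app φ (Sum.elim fv ![&1, &3]) ⇔ (&3 =' &2)))) ⟹
      ∃' ∀' ((&2 ∈ₛ &1) ⇔ ∃' ((&3 ∈ₛ &0) ⊓ app φ (Sum.elim fv ![&3, &2])))))

/-- The axioms of ZF* other than Extensionality and Foundation. -/
inductive ZFStarNoExtNoFoundAx : LSet.Sentence → Prop
  | pairing : ZFStarNoExtNoFoundAx pairing
  | union : ZFStarNoExtNoFoundAx union
  | power : ZFStarNoExtNoFoundAx power
  | infinity : ZFStarNoExtNoFoundAx infinity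
  | replacementStar (φ : LSet.Formula (Fin 2)) : ZFStarNoExtNoFoundAx (replacementStar φ)

/-- ZF* without Extensionality and without Foundation. -/
def ZFStarNoExtNoFound : LSet.Theory := {σ | ZFStarNoExtNoFoundAx σ}

/-- ZF* without Extensionality. -/
def ZFStarNoExt : LSet.Theory := insert foundation ZFStarNoExtNoFound

/-- The axioms of Zermelo–Fraenkel set theory. -/
inductive ZFAx : LSet.Sentence → Prop
  | extensionality : ZFAx extensionality
  | foundation : ZFAx foundation
  | pairing : ZFAx pairing
  | union : ZFAx union
  | power : ZFAx power
  | infinity : ZFAx infinity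
  | separation {n : ℕ} (φ : LSet.Formula (Fin n ⊕ Fin 1)) : ZFAx (separation φ)
  | replacement {n : ℕ} (φ : LSet.Formula (Fin n ⊕ Fin 2)) : ZFAx (replacement φ)

/-- Zermelo–Fraenkel set theory. -/
def ZF : LSet.Theory := {σ | ZFAx σ}

/-! ### Relative interpretations -/

/-- The data of a relative interpretation of the language of set theory in itself: formulas
for the domain, for equality, and for membership. -/
structure Interp where
  dom : LSet.Formula (Fin 1)
  eq : LSet.Formula (Fin 2)
  mem : LSet.Formula (Fin 2)

/-- The translation of formulas: the atomic formulas are replaced by the interpreting ones and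
the quantifiers are relativized to the domain. -/
def Interp.tr (τ : Interp) {α : Type} : {n : ℕ} → LSet.BoundedFormula α n → LSet.BoundedFormula α n
  | _, .falsum => .falsum
  | _, .equal s t => app τ.eq ![s, t]
  | _, .rel MemRel.mem ts => app τ.mem ts
  | _, .imp φ ψ => (τ.tr φ).imp (τ.tr ψ)
  | n, .all φ => ∀' (app τ.dom ![&(Fin.last n)] ⟹ τ.tr φ)

/-- `τ` interprets `S` in `T`: the translation of every theorem of `S` is a theorem of `T`.
(As theorems of `S` include the logical truths, this makes the domain provably nonempty and the
interpreted equality provably a congruence.) -/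
def Interp.Interprets (τ : Interp) (T S : LSet.Theory) : Prop :=
  ∀ σ : LSet.Sentence, S ⊨ᵇ σ → T ⊨ᵇ τ.tr σ

/-! ### Co-extensionality, sets, pure sets -/

/-- `x =* y`: `x` and `y` are co-extensional. -/
def coext : LSet.Formula (Fin 2) := ∀' ((&0 ∈ₛ fv 0) ⇔ (&0 ∈ₛ fv 1))

/-- `y` is a set: a class closed under co-extensionality. -/
def isSet : LSet.Formula (Fin 1) :=
  ∀' ∀' (app coext ![&0, &1] ⟹ ((&0 ∈ₛ fv 0) ⇔ (&1 ∈ₛ fv 0)))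

/-- `x ∈* y`: `y` is a set and `x ∈ y`. -/
def memStar : LSet.Formula (Fin 2) := app isSet ![fv 1] ⊓ (fv 0 ∈ₛ fv 1)

/-- `x ⊆ y` -/
def subset : LSet.Formula (Fin 2) := ∀' ((&0 ∈ₛ fv 0) ⟹ (&0 ∈ₛ fv 1))

/-- `x` is transitive. -/
def transitive : LSet.Formula (Fin 1) := ∀' ((&0 ∈ₛ fv 0) ⟹ app subset ![&0, fv 0])

/-- `t` (variable 1) is a transitive closure of `x` (variable 0): a least transitive class that
includes `x`. -/
def isTC : LSet.Formula (Fin 2) :=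
  app subset ![fv 0, fv 1] ⊓ app transitive ![fv 1] ⊓
    ∀' ((app subset ![fv 0, &0] ⊓ app transitive ![&0]) ⟹ app subset ![fv 1, &0])

/-- `x` is a pure (hereditary) set: `x` is a set with a transitive closure all of whose elements
are sets. -/
def pure : LSet.Formula (Fin 1) :=
  app isSet ![fv 0] ⊓ ∃' (app isTC ![fv 0, &0] ⊓ ∀' ((&1 ∈ₛ &0) ⟹ app isSet ![&1]))

/-- The interpretation on the pure sets, with `=*` for equality and `∈*` for membership. -/
def pureInterp : Interp := ⟨pure, coext, memStar⟩

/-! ### Cumulative hierarchies -/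

/-- `x` is empty. -/
def isEmpty : LSet.Formula (Fin 1) := ∀' ∼(&0 ∈ₛ fv 0)

/-- `x = {a, b}`, for the variables `x, a, b`. -/
def isPair : LSet.Formula (Fin 3) :=
  ∀' ((&0 ∈ₛ fv 0) ⇔ ((&0 =' fv 1) ⊔ (&0 =' fv 2)))

/-- `p = {{a}, {a, b}}`, for the variables `p, a, b`. -/
def isOrderedPair : LSet.Formula (Fin 3) :=
  ∃' ∃' (app isPair ![&0, fv 1, fv 1] ⊓ app isPair ![&1, fv 1, fv 2] ⊓
    app isPair ![fv 0, &0, &1])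

/-- `c = a ∪ {a}`, for the variables `a, c`. -/
def isSucc : LSet.Formula (Fin 2) :=
  ∀' ((&0 ∈ₛ fv 1) ⇔ ((&0 ∈ₛ fv 0) ⊔ (&0 =' fv 0)))

/-- `b` is the power set of `a`, for the variables `a, b`. -/
def isPower : LSet.Formula (Fin 2) := ∀' ((&0 ∈ₛ fv 1) ⇔ app subset ![&0, fv 0])

/-- `d` is a von Neumann ordinal: a transitive set of transitive sets on which membership is
well-founded. -/
def isOrdinal : LSet.Formula (Fin 1) :=
  app transitive ![fv 0] ⊓ (∀' ((&0 ∈ₛ fv 0) ⟹ app transitive ![&0])) ⊓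
    ∀' ((app subset ![&0, fv 0] ⊓ ∃' (&1 ∈ₛ &0)) ⟹
      ∃' ((&1 ∈ₛ &0) ⊓ ∼(∃' ((&2 ∈ₛ &0) ⊓ (&2 ∈ₛ &1)))))

/-- `x` is neither empty nor a successor (for an ordinal: `x` is a limit). -/
def isLimit : LSet.Formula (Fin 1) :=
  ∼(app isEmpty ![fv 0]) ⊓ ∼(∃' app isSucc ![&0, fv 0])

/-- `(a, b) ∈ F`, for the variables `F, a, b`. -/
def maps : LSet.Formula (Fin 3) :=
  ∃' ((&0 ∈ₛ fv 0) ⊓ app isOrderedPair ![&0, fv 1, fv 2])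

/-- `F` is a function with domain `d`, for the variables `F, d`. -/
def isFunOn : LSet.Formula (Fin 2) :=
  (∀' ((&0 ∈ₛ fv 0) ⟹ ∃' ∃' ((&1 ∈ₛ fv 1) ⊓ app isOrderedPair ![&0, &1, &2]))) ⊓
  (∀' ((&0 ∈ₛ fv 1) ⟹ ∃' app maps ![fv 0, &0, &1])) ⊓
  ∀' ∀' ∀' ((app maps ![fv 0, &0, &1] ⊓ app maps ![fv 0, &0, &2]) ⟹ (&1 =' &2))

/-- `F` is a hierarchy-building function: its domain is an ordinal, `F(0) = ∅`, `F(a + 1)` is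
the power set of `F(a)`, and `F(l) = ⋃ a ∈ l, F(a)` for limits `l`. -/
def isHierarchy : LSet.Formula (Fin 1) :=
  (∃' (app isOrdinal ![&0] ⊓ app isFunOn ![fv 0, &0])) ⊓
  (∀' ∀' ((app isEmpty ![&0] ⊓ app maps ![fv 0, &0, &1]) ⟹ app isEmpty ![&1])) ⊓
  (∀' ∀' ∀' ∀' ((app isSucc ![&0, &1] ⊓ app maps ![fv 0, &0, &2] ⊓ app maps ![fv 0, &1, &3]) ⟹
    app isPower ![&2, &3])) ⊓
  ∀' ∀' ((app isLimit ![&0] ⊓ app maps ![fv 0, &0, &1]) ⟹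
    ∀' ((&2 ∈ₛ &1) ⇔
      ∃' ∃' ((&3 ∈ₛ &0) ⊓ app maps ![fv 0, &3, &4] ⊓ (&2 ∈ₛ &4))))

/-- `x` is an element of some value of a hierarchy-building function. -/
def inHierarchy : LSet.Formula (Fin 1) :=
  ∃' ∃' ∃' (app isHierarchy ![&0] ⊓ app maps ![&0, &1, &2] ⊓ (fv 0 ∈ₛ &2))

/-- The interpretation on those pure sets that are elements of stages of cumulative hierarchies,
the hierarchies being built in the universe of pure sets with `=*` and `∈*`. Again `=*` stands
for equality and `∈*` for membership. -/
def hierarchyInterp : Interp := ⟨pure ⊓ pureInterp.tr inHierarchy, coext, memStar⟩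

end SetInterp

/-! Theoremhood is semantic consequence here, so both parts become constructions inside an arbitrary
model `M` of the weak theory. If an interpretation `Yields` a structure `N` from `M`, then the
translation of a sentence holds in `M` exactly when the sentence holds in `N`
(`Interp.Yields.realize_sentence`). It remains to see that the yielded structures are nonempty
models of ZF.

Part 1: the structure is `PureSets M`, the pure sets modulo co-extensionality. The first obstacle is
that Replacement* has no parameters. They are recovered one at a time: a parameter is packed into
the elements of the domain class, where a parameter-free formula can decode it
(`StarModel.code_step`). Replacement* returns every co-extensional variant of each value, so its
classes are closed under co-extensionality; Separation also follows, since an argument to be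
discarded can be sent to the nonexistent Russell class. A closed class of pure sets is pure
(`StarModel.pure_of_forall_mem`), and most axioms of ZF follow from this. Infinity is harder, as the
given inductive class need not contain pure sets. Its elements are replaced by well-founded pure
sets bisimilar to them, which are unique up to co-extensionality (`StarModel.bisim_unique`).
Foundation plays no role so far, and it passes from `M` to `PureSets M`.

Part 2: without Foundation, `PureSets M` is a model of ZF minus Foundation. The elements of its
cumulative hierarchies form a transitive class that contains every set included in it
(`ZFModel.inStage_of_forall_mem`), so the axioms relativize to it. Foundation holds there because an
element of least stage is minimal (`ZFModel.exists_minimal`). -/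

namespace SetInterp

open Language

/-! ### Satisfaction of substituted and universally closed formulas. -/

section Semantics

variable {U : Type} [LSet.Structure U]

/-- Membership in a structure for the language of set theory. -/
def E (x y : U) : Prop := Structure.RelMap (L := LSet) MemRel.mem ![x, y]

@[simp] theorem realize_memF {α : Type} {n : ℕ} (s t : LSet.Term (α ⊕ Fin n)) (v : α → U)
    (xs : Fin n → U) :
    (s ∈ₛ t).Realize v xs ↔ E (s.realize (Sum.elim v xs)) (t.realize (Sum.elim v xs)) :=
  BoundedFormula.realize_rel₂

@[simp] theorem realize_fv {α : Type} {n : ℕ} (i : α) (v : α → U) (xs : Fin n → U) :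
    (fv i : LSet.Term (α ⊕ Fin n)).realize (Sum.elim v xs) = v i := rfl

@[simp] theorem realize_app {α β : Type} {n : ℕ} (φ : LSet.Formula β)
    (ts : β → LSet.Term (α ⊕ Fin n)) (v : α → U) (xs : Fin n → U) :
    (app φ ts).Realize v xs ↔ φ.Realize (fun b => (ts b).realize (Sum.elim v xs)) := by
  unfold app
  rw [BoundedFormula.realize_relabel]
  rw [BoundedFormula.realize_subst]
  unfold Formula.Realize
  have h : (Sum.elim v (xs ∘ Fin.castAdd 0) ∘ id : α ⊕ Fin n → U) = Sum.elim v xs := rfl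
  rw [h]
  exact iff_of_eq (congrArg _ (Subsingleton.elim _ _))

theorem realize_close {n : ℕ} (φ : LSet.Formula (Fin n)) :
    (close φ).Realize U ↔ ∀ p : Fin n → U, φ.Realize p := by
  unfold close Sentence.Realize
  rw [BoundedFormula.realize_alls]
  refine forall_congr' fun p => ?_
  rw [BoundedFormula.realize_relabel]
  unfold Formula.Realize
  have h : (Sum.elim (default : Empty → U) (p ∘ Fin.castAdd 0) ∘ Sum.inr : Fin n → U) = p := rfl
  rw [h]
  exact iff_of_eq (congrArg _ (Subsingleton.elim _ _))

end Semantics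

/-! ### Interpretations in structures -/

/-- The interpretation `τ` in `M` yields the structure `N`, through a map `π` from the domain
`δ` onto `N`. -/
structure Interp.Yields (τ : Interp) {M N : Type} [LSet.Structure M] [LSet.Structure N]
    {δ : M → Prop} (π : {x // δ x} → N) : Prop where
  dom : ∀ x, τ.dom.Realize (fun _ => x) ↔ δ x
  eq : ∀ x y, τ.eq.Realize ![x.1, y.1] ↔ π x = π y
  mem : ∀ x y, τ.mem.Realize ![x.1, y.1] ↔ E (π x) (π y)
  surj : Function.Surjective π

section Translation

variable {M N : Type} [LSet.Structure M] [LSet.Structure N] {δ : M → Prop} {π : {x // δ x} → N}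
  {τ : Interp}

theorem Interp.Yields.term (π : {x // δ x} → N) {α : Type} {n : ℕ} (t : LSet.Term (α ⊕ Fin n))
    (v : α → {x // δ x}) (xs : Fin n → {x // δ x}) :
    ∃ x : {x // δ x}, t.realize (Sum.elim (fun a => (v a).1) (fun i => (xs i).1)) = x.1 ∧
      t.realize (Sum.elim (π ∘ v) (π ∘ xs)) = π x := by
  cases t with
  | var a => cases a with
    | inl a => exact ⟨v a, rfl, rfl⟩
    | inr i => exact ⟨xs i, rfl, rfl⟩
  | func f => exact f.elim

/-- Induction on the formula: atomic formulas are handled by `eq` and `mem`, and quantifiers match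
because `π` is onto and `dom` defines its source. -/
theorem Interp.Yields.realize_tr (h : τ.Yields π) {α : Type} {n : ℕ} (φ : LSet.BoundedFormula α n)
    (v : α → {x // δ x}) (xs : Fin n → {x // δ x}) :
    (τ.tr φ).Realize (fun a => (v a).1) (fun i => (xs i).1) ↔ φ.Realize (π ∘ v) (π ∘ xs) := by
  induction φ with
  | falsum => rfl
  | equal s t =>
    obtain ⟨x, hx, hx'⟩ := Interp.Yields.term π s v xs
    obtain ⟨y, hy, hy'⟩ := Interp.Yields.term π t v xs
    change (app τ.eq ![s, t]).Realize _ _ ↔ _ = _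
    rw [realize_app, hx', hy', ← h.eq, ← hx, ← hy]
    refine iff_of_eq (congrArg _ (funext fun i => ?_))
    fin_cases i <;> rfl
  | rel R ts =>
    cases R
    obtain ⟨x, hx, hx'⟩ := Interp.Yields.term π (ts 0) v xs
    obtain ⟨y, hy, hy'⟩ := Interp.Yields.term π (ts 1) v xs
    change (app τ.mem ts).Realize _ _ ↔ Structure.RelMap _ _
    have hE : (fun i => (ts i).realize (Sum.elim (π ∘ v) (π ∘ xs))) = ![π x, π y] := by
      funext i; fin_cases i
      exacts [hx', hy']
    rw [hE]
    change _ ↔ E (π x) (π y)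
    rw [realize_app, ← h.mem, ← hx, ← hy]
    refine iff_of_eq (congrArg _ (funext fun i => ?_))
    fin_cases i <;> rfl
  | imp φ ψ ih₁ ih₂ => exact imp_congr (ih₁ xs) (ih₂ xs)
  | @all n φ ih =>
    have key : ∀ a : {x // δ x}, (τ.tr φ).Realize (fun a => (v a).1)
        (Fin.snoc (α := fun _ => M) (fun i => (xs i).1) a.1) ↔
        φ.Realize (π ∘ v) (Fin.snoc (α := fun _ => N) (π ∘ xs) (π a)) := by
      intro a
      rw [← Fin.comp_snoc π xs a, ← ih]
      have : (Fin.snoc (fun i => (xs i).1) a.1 : Fin (n + 1) → M) =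
        fun i => ((Fin.snoc xs a : Fin (n + 1) → {x // δ x}) i).1 :=
        (Fin.comp_snoc Subtype.val xs a).symm
      rw [this]
    change (∀' (app τ.dom ![&(Fin.last n)] ⟹ τ.tr φ)).Realize _ _ ↔ φ.all.Realize _ _
    simp only [BoundedFormula.realize_all, BoundedFormula.realize_imp, realize_app]
    have hd : ∀ a : M, (τ.dom.Realize fun b => ((![&(Fin.last n)] : Fin 1 → LSet.Term
        (α ⊕ Fin (n + 1))) b).realize (Sum.elim (fun a => (v a).1)
          (Fin.snoc (α := fun _ => M) (fun i => (xs i).1) a))) ↔ δ a := by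
      intro a
      rw [← h.dom a]
      refine iff_of_eq (congrArg _ (funext fun b => ?_))
      fin_cases b
      exact Fin.snoc_last (α := fun _ => M) a (fun i => (xs i).1)
    constructor
    · intro H b
      obtain ⟨a, rfl⟩ := h.surj b
      exact (key a).1 (H a.1 ((hd _).2 a.2))
    · intro H a ha
      exact (key ⟨a, (hd a).1 ha⟩).2 (H _)

theorem Interp.Yields.realize_sentence (h : τ.Yields π) (σ : LSet.Sentence) :
    BoundedFormula.Realize (τ.tr σ) (default : Empty → M) default ↔ N ⊨ σ := by
  have := h.realize_tr σ Empty.elim Fin.elim0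
  unfold Sentence.Realize Formula.Realize
  convert this using 2

end Translation

/-! ### Definable predicates -/

section Definability

variable {U : Type} [LSet.Structure U] {α : Type}

/-- `t` is a parameter among the `v` or one of the variables. -/
class Tm (v : α → U) {n : ℕ} (t : (Fin n → U) → U) : Prop where
  out : ∃ s : LSet.Term (α ⊕ Fin n), ∀ xs, s.realize (Sum.elim v xs) = t xs

/-- `P` is definable with parameters among the `v`. -/
class Dfn (v : α → U) {n : ℕ} (P : (Fin n → U) → Prop) : Prop where
  out : ∃ φ : LSet.BoundedFormula α n, ∀ xs, φ.Realize v xs ↔ P xs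

variable {v : α → U} {n : ℕ}

instance Tm.var (i : Fin n) : Tm v (fun xs => xs i) := ⟨&i, fun _ => rfl⟩

instance Tm.param (a : α) : Tm v (n := n) (fun _ => v a) := ⟨.var (.inl a), fun _ => rfl⟩

instance Tm.const (c : U) : Tm (id : U → U) (n := n) (fun _ => c) := ⟨.var (.inl c), fun _ => rfl⟩

/-- A term keeps its meaning when a quantifier adds a variable. With this instance and the ones
below, instance search finds the defining formula of a predicate from its shape. -/
instance Tm.lift {m : ℕ} (t : (Fin n → U) → U) (f : Fin n → Fin m) [Tm v t] :
    Tm v (fun xs : Fin m → U => t (fun i => xs (f i))) := by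
  obtain ⟨s, hs⟩ := Tm.out (v := v) (t := t)
  refine ⟨s.relabel (Sum.map id f), fun xs => ?_⟩
  rw [Term.realize_relabel, ← hs]
  congr 1
  funext i
  cases i <;> rfl

instance Dfn.mem (s t : (Fin n → U) → U) [Tm v s] [Tm v t] : Dfn v (fun xs => E (s xs) (t xs)) := by
  obtain ⟨s', hs⟩ := Tm.out (v := v) (t := s)
  obtain ⟨t', ht⟩ := Tm.out (v := v) (t := t)
  exact ⟨memF s' t', fun xs => by rw [realize_memF, hs, ht]⟩

instance Dfn.eq (s t : (Fin n → U) → U) [Tm v s] [Tm v t] : Dfn v (fun xs => s xs = t xs) := by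
  obtain ⟨s', hs⟩ := Tm.out (v := v) (t := s)
  obtain ⟨t', ht⟩ := Tm.out (v := v) (t := t)
  exact ⟨s' =' t', fun xs => by simp only [BoundedFormula.realize_bdEqual, hs, ht]⟩

instance Dfn.not (P : (Fin n → U) → Prop) [Dfn v P] : Dfn v (fun xs => ¬ P xs) := by
  obtain ⟨φ, h⟩ := Dfn.out (v := v) (P := P)
  exact ⟨∼φ, fun xs => by rw [BoundedFormula.realize_not, h]⟩

instance Dfn.imp (P Q : (Fin n → U) → Prop) [Dfn v P] [Dfn v Q] : Dfn v (fun xs => P xs → Q xs) := by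
  obtain ⟨φ, h⟩ := Dfn.out (v := v) (P := P)
  obtain ⟨ψ, h'⟩ := Dfn.out (v := v) (P := Q)
  exact ⟨φ ⟹ ψ, fun xs => by rw [BoundedFormula.realize_imp, h, h']⟩

instance Dfn.and (P Q : (Fin n → U) → Prop) [Dfn v P] [Dfn v Q] : Dfn v (fun xs => P xs ∧ Q xs) := by
  obtain ⟨φ, h⟩ := Dfn.out (v := v) (P := P)
  obtain ⟨ψ, h'⟩ := Dfn.out (v := v) (P := Q)
  exact ⟨φ ⊓ ψ, fun xs => by rw [BoundedFormula.realize_inf, h, h']⟩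

instance Dfn.or (P Q : (Fin n → U) → Prop) [Dfn v P] [Dfn v Q] : Dfn v (fun xs => P xs ∨ Q xs) := by
  obtain ⟨φ, h⟩ := Dfn.out (v := v) (P := P)
  obtain ⟨ψ, h'⟩ := Dfn.out (v := v) (P := Q)
  exact ⟨φ ⊔ ψ, fun xs => by rw [BoundedFormula.realize_sup, h, h']⟩

instance Dfn.iff (P Q : (Fin n → U) → Prop) [Dfn v P] [Dfn v Q] :
    Dfn v (fun xs => (P xs ↔ Q xs)) := by
  obtain ⟨φ, h⟩ := Dfn.out (v := v) (P := P)
  obtain ⟨ψ, h'⟩ := Dfn.out (v := v) (P := Q)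
  exact ⟨φ ⇔ ψ, fun xs => by rw [BoundedFormula.realize_iff, h, h']⟩

instance Dfn.all (P : (Fin n → U) → U → Prop)
    [Dfn v (fun ys : Fin (n + 1) → U => P (fun i => ys i.castSucc) (ys (Fin.last n)))] :
    Dfn v (fun xs => ∀ a, P xs a) := by
  obtain ⟨φ, h⟩ := Dfn.out (v := v)
    (P := fun ys : Fin (n + 1) → U => P (fun i => ys i.castSucc) (ys (Fin.last n)))
  exact ⟨∀' φ, fun xs => by simp [h]⟩

instance Dfn.ex (P : (Fin n → U) → U → Prop)
    [Dfn v (fun ys : Fin (n + 1) → U => P (fun i => ys i.castSucc) (ys (Fin.last n)))] :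
    Dfn v (fun xs => ∃ a, P xs a) := by
  obtain ⟨φ, h⟩ := Dfn.out (v := v)
    (P := fun ys : Fin (n + 1) → U => P (fun i => ys i.castSucc) (ys (Fin.last n)))
  exact ⟨∃' φ, fun xs => by simp [h]⟩

theorem Dfn.congr {P Q : (Fin n → U) → Prop} [h : Dfn v P] (e : ∀ xs, P xs ↔ Q xs) : Dfn v Q := by
  rwa [← funext fun xs => propext (e xs)]

theorem Dfn.formula {β : Type} (φ : LSet.Formula β) (f : β → (Fin n → U) → U) [∀ b, Tm v (f b)] :
    Dfn v (fun xs => φ.Realize (fun b => f b xs)) := by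
  choose s hs using fun b => Tm.out (v := v) (t := f b)
  exact ⟨app φ s, fun xs => by simp only [realize_app, hs]⟩

theorem Dfn.bounded {β : Type} {m : ℕ} (φ : LSet.BoundedFormula β m) (f : β → (Fin n → U) → U)
    (g : Fin m → (Fin n → U) → U) [hf : ∀ b, Tm v (f b)] [hg : ∀ b, Tm v (g b)] :
    Dfn v (fun xs => φ.Realize (fun b => f b xs) (fun i => g i xs)) := by
  have : ∀ b, Tm v (Sum.elim f g b) := by rintro (b | b); exacts [hf b, hg b]
  have := Dfn.formula (v := v) φ.toFormula (Sum.elim f g)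
  exact Dfn.congr (h := this) fun xs => BoundedFormula.realize_toFormula _ _

theorem Dfn.comp {m : ℕ} (P : (Fin m → U) → Prop) (g : Fin m → (Fin n → U) → U) [h : Dfn v P]
    [∀ i, Tm v (g i)] : Dfn v (fun xs => P (fun i => g i xs)) := by
  obtain ⟨φ, h⟩ := h
  have := Dfn.bounded (v := v) (n := n) φ (fun a _ => v a) g
  simpa only [h] using this

/-- When the definability of `P` is only a hypothesis, instance search cannot look inside `P`. This
version for arbitrary terms can be put in the context as a local instance. -/
theorem Dfn.comp₁ {P : U → Prop} (h : Dfn v (fun xs : Fin 1 → U => P (xs 0)))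
    (t : (Fin n → U) → U) [Tm v t] : Dfn v (fun xs => P (t xs)) :=
  Dfn.comp (v := v) (fun xs : Fin 1 → U => P (xs 0)) (fun _ => t)

theorem Dfn.comp₂ {P : U → U → Prop} (h : Dfn v (fun xs : Fin 2 → U => P (xs 0) (xs 1)))
    (s t : (Fin n → U) → U) [hs : Tm v s] [ht : Tm v t] : Dfn v (fun xs => P (s xs) (t xs)) := by
  have : ∀ i, Tm v (![s, t] i) := by intro i; fin_cases i; exacts [hs, ht]
  exact Dfn.comp (v := v) (fun xs : Fin 2 → U => P (xs 0) (xs 1)) ![s, t]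

theorem Dfn.comp₃ {P : U → U → U → Prop}
    (h : Dfn v (fun xs : Fin 3 → U => P (xs 0) (xs 1) (xs 2)))
    (s t u : (Fin n → U) → U) [hs : Tm v s] [ht : Tm v t] [hu : Tm v u] :
    Dfn v (fun xs => P (s xs) (t xs) (u xs)) := by
  have : ∀ i, Tm v (![s, t, u] i) := by intro i; fin_cases i; exacts [hs, ht, hu]
  exact Dfn.comp (v := v) (fun xs : Fin 3 → U => P (xs 0) (xs 1) (xs 2)) ![s, t, u]

/-- A predicate that is definable with some parameters needs only finitely many of them. -/
theorem Dfn.finite {P : (Fin n → U) → Prop} (h : Dfn v P) :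
    ∃ (k : ℕ) (p : Fin k → U), Dfn p P := by
  classical
  obtain ⟨φ, h⟩ := h
  let e := φ.freeVarFinset.equivFin
  refine ⟨_, fun i => v (e.symm i), φ.restrictFreeVar e, fun xs => ?_⟩
  rw [BoundedFormula.realize_restrictFreeVar v (fun a => by simp), h]

variable {M N : Type} [LSet.Structure M] [LSet.Structure N] {δ : M → Prop} {π : {x // δ x} → N}
  {τ : Interp}

/-- The preimage of a definable predicate under an interpretation is definable. -/
theorem Interp.Yields.dfn (h : τ.Yields π) {P : (Fin n → N) → Prop} (hP : Dfn id P) :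
    Dfn (id : M → M) (fun xs => ∃ hx : ∀ i, δ (xs i), P (fun i => π ⟨xs i, hx i⟩)) := by
  obtain ⟨φ, hφ⟩ := hP
  -- Parameters from `N` are replaced by representatives in `M`; the translated formula with these
  -- parameters defines the preimage.
  choose r hr using h.surj
  have hδ : Dfn (id : M → M) (fun xs : Fin n → M => ∀ i, δ (xs i)) := by
    refine ⟨BoundedFormula.iInf (fun i : Fin n => app τ.dom ![&i]), fun xs => ?_⟩
    simp only [BoundedFormula.realize_iInf, realize_app, ← h.dom]
    refine forall_congr' fun i => iff_of_eq (congrArg _ (funext fun b => ?_))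
    fin_cases b; rfl
  have h1 : Dfn (id : M → M) (fun xs : Fin n → M => (τ.tr φ).Realize (fun a => (r a).1) xs) :=
    Dfn.bounded (v := (id : M → M)) (τ.tr φ) (fun a _ => (r a).1) (fun i xs => xs i)
  refine Dfn.congr (P := fun xs => (∀ i, δ (xs i)) ∧ (τ.tr φ).Realize (fun a => (r a).1) xs)
    fun xs => ?_
  rw [← exists_prop]
  refine exists_congr fun hx => ?_
  rw [h.realize_tr φ r (fun i => ⟨xs i, hx i⟩), ← hφ]
  have : π ∘ r = id := funext hr
  rw [this]; rfl

end Definability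

/-! ### Replacement* with parameters. -/

section Star

variable {M : Type} [LSet.Structure M]

/-- Replacement* for predicates that are definable with parameters among the `v`. -/
def StarReplacement {α : Type} (v : α → M) : Prop :=
  ∀ P : M → M → Prop, Dfn v (fun xs : Fin 2 → M => P (xs 0) (xs 1)) →
    ∀ A, ∃ B, ∀ Y, E Y B ↔ ∃ X, E X A ∧ ∀ Z, E Z Y ↔ P X Z

variable (M) in
/-- Models of ZF* without Extensionality and without Foundation. -/
structure StarModel : Prop where
  pairing : ∀ a b : M, ∃ x, ∀ y, E y x ↔ y = a ∨ y = b
  union : ∀ a : M, ∃ x, ∀ y, E y x ↔ ∃ z, E z a ∧ E y z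
  power : ∀ a : M, ∃ x, ∀ y, E y x ↔ ∀ z, E z y → E z a
  infinity : ∃ N : M, (∃ e, E e N ∧ ∀ z, ¬ E z e) ∧
    ∀ x, E x N → ∃ m, E m N ∧ ∀ y, E y m ↔ E y x ∨ y = x
  replacement : StarReplacement (Empty.elim : Empty → M)

variable {α : Type} {v : α → M} {n : ℕ}

/-- `x = {a, b}` -/
def Pr (x a b : M) : Prop := ∀ y, E y x ↔ y = a ∨ y = b

instance Dfn.pr (r s t : (Fin n → M) → M) [Tm v r] [Tm v s] [Tm v t] :
    Dfn v (fun xs => Pr (r xs) (s xs) (t xs)) := by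
  unfold Pr; infer_instance

/-- `x = {{z}, {e, {q}}}` for an empty class `e`. The two elements of `x` can be told apart, so
`x` determines `z` and `q`. -/
def Code (x z q : M) : Prop :=
  ∃ s c e r, Pr x s c ∧ Pr s z z ∧ Pr c e r ∧ (∀ y, ¬ E y e) ∧ Pr r q q

instance Dfn.code (r s t : (Fin n → M) → M) [Tm v r] [Tm v s] [Tm v t] :
    Dfn v (fun xs => Code (r xs) (s xs) (t xs)) := by
  unfold Code; infer_instance

theorem singleton_ne_tag {s z c e r q : M} (hs : Pr s z z) (hc : Pr c e r) (he : ∀ y, ¬ E y e)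
    (hr : Pr r q q) : s ≠ c := by
  rintro rfl
  have h1 : e = z := by simpa using (hs e).1 ((hc e).2 (.inl rfl))
  have h2 : r = z := by simpa using (hs r).1 ((hc r).2 (.inr rfl))
  exact he q (h1 ▸ h2 ▸ (hr q).2 (.inl rfl))

theorem Pr.singleton_inj {s z z' : M} (h : Pr s z z) (h' : Pr s z' z') : z = z' := by
  simpa using (h' z).1 ((h z).2 (.inl rfl))

/-- The parameter `q` is moved into the domain. Instead of `z` in `A`, the arguments are codes
`{{z}, c}` with the fixed tag `c = {e, {q}}`; all of these lie in the power class `W` of the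
singletons of elements of `A` together with `c`. A formula with one parameter fewer reads `z` and
`q` off a code. Other elements of `W` must contribute no value. -/
theorem StarModel.code_step (hM : StarModel M) {k : ℕ} (p : Fin k → M) (q : M)
    (hp : StarReplacement p) : StarReplacement (Fin.cons q p : Fin (k + 1) → M) := by
  intro P hP A
  obtain ⟨Q, hQ, hQP⟩ : ∃ Q : M → M → M → Prop,
      Dfn p (fun xs : Fin 3 → M => Q (xs 0) (xs 1) (xs 2)) ∧ ∀ X Z, Q q X Z ↔ P X Z := by
    obtain ⟨φ, hφ⟩ := hP
    refine ⟨fun q' X Z => φ.Realize (Fin.cons q' p : Fin (k + 1) → M) ![X, Z], ?_,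
      fun X Z => hφ ![X, Z]⟩
    let f : Fin (k + 1) → (Fin 3 → M) → M := Fin.cases (fun xs => xs 0) (fun i _ => p i)
    let g : Fin 2 → (Fin 3 → M) → M := ![fun xs => xs 1, fun xs => xs 2]
    have hf : ∀ b, Tm p (f b) := by
      intro b
      refine Fin.cases ?_ (fun i => ?_) b
      · exact Tm.var 0
      · exact Tm.param i
    have hg : ∀ b, Tm p (g b) := by
      intro b; fin_cases b
      · exact Tm.var 1
      · exact Tm.var 2
    have := Dfn.bounded (v := p) φ f g
    refine Dfn.congr (h := this) fun xs => iff_of_eq ?_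
    congr 1
    · funext b; refine Fin.cases rfl (fun i => rfl) b
    · funext b; fin_cases b <;> rfl
  have hQ' := fun {n} (r s t : (Fin n → M) → M) [Tm p r] [Tm p s] [Tm p t] =>
    Dfn.comp₃ hQ r s t
  obtain ⟨N, ⟨e, -, he⟩, -⟩ := hM.infinity
  obtain ⟨A₁, hA₁⟩ := hp (fun X Z => Z = X) inferInstance A
  obtain ⟨r, hr⟩ := hM.pairing q q
  obtain ⟨c, hc⟩ := hM.pairing e r
  obtain ⟨c', hc'⟩ := hM.pairing c c
  obtain ⟨d, hd⟩ := hM.pairing A₁ c'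
  obtain ⟨u, hu⟩ := hM.union d
  obtain ⟨W, hW⟩ := hM.power u
  have hu' : ∀ y, E y u ↔ E y A₁ ∨ y = c := by
    intro y
    rw [hu]
    constructor
    · rintro ⟨z, hz, hy⟩
      rcases (hd z).1 hz with rfl | rfl
      · exact .inl hy
      · exact .inr (by simpa using (hc' y).1 hy)
    · rintro (hy | rfl)
      · exact ⟨A₁, (hd _).2 (.inl rfl), hy⟩
      · exact ⟨c', (hd _).2 (.inr rfl), (hc' _).2 (.inl rfl)⟩
  -- Inside `W` a code can only decode to an element of `A` and to `q`: a singleton is never a tag,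
  -- so the two components cannot be exchanged, and `c` is the only tag available.
  have hcode : ∀ X z q', E X W → Code X z q' → E z A ∧ q' = q := by
    rintro X z q' hX ⟨s', c'', e', r', h1, h2, h3, h4, h5⟩
    have hs := (hu' s').1 ((hW X).1 hX s' ((h1 s').2 (.inl rfl)))
    have hcc := (hu' c'').1 ((hW X).1 hX c'' ((h1 c'').2 (.inr rfl)))
    constructor
    · rcases hs with hs | rfl
      · obtain ⟨z', hz', h⟩ := (hA₁ s').1 hs
        have : z = z' := (h z).1 ((h2 z).2 (.inl rfl))
        exact this ▸ hz'
      · exact (singleton_ne_tag h2 hc he hr rfl).elim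
    · rcases hcc with hcc | rfl
      · obtain ⟨z', -, h⟩ := (hA₁ c'').1 hcc
        have h : Pr c'' z' z' := fun y => by rw [h, or_self]
        exact (singleton_ne_tag h h3 h4 h5 rfl).elim
      · rcases (hc r').1 ((h3 r').2 (.inr rfl)) with rfl | rfl
        · exact (he q' ((h5 q').2 (.inl rfl))).elim
        · exact Pr.singleton_inj h5 hr
  -- For an `X` that is not a code, the second disjunct describes the Russell class. No `Y` has that
  -- extension, so such an `X` adds nothing to `B`.
  obtain ⟨B, hB⟩ := hp (fun X Z => (∃ z q', Code X z q' ∧ Q q' z Z) ∨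
    ((¬ ∃ z q', Code X z q') ∧ ¬ E Z Z)) inferInstance W
  refine ⟨B, fun Y => ?_⟩
  rw [hB]
  constructor
  · rintro ⟨X, hX, hY⟩
    by_cases h : ∃ z q', Code X z q'
    · obtain ⟨z, q', hz⟩ := h
      obtain ⟨hzA, rfl⟩ := hcode X z q' hX hz
      refine ⟨z, hzA, fun Z => ?_⟩
      rw [hY, ← hQP]
      constructor
      · rintro (⟨z', q'', h1, h2⟩ | ⟨h1, -⟩)
        · obtain ⟨s, c1, e1, r1, i1, i2, i3, i4, i5⟩ := hz
          obtain ⟨s', c1', e1', r1', j1, j2, j3, j4, j5⟩ := h1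
          have hs : s = s' := by
            rcases (j1 s).1 ((i1 s).2 (.inl rfl)) with h | h
            · exact h
            · exact (singleton_ne_tag i2 j3 j4 j5 h).elim
          subst hs
          obtain rfl := Pr.singleton_inj i2 j2
          obtain ⟨-, rfl⟩ := hcode X z q'' hX ⟨s, c1', e1', r1', j1, j2, j3, j4, j5⟩
          exact h2
        · exact (h1 ⟨z, q', hz⟩).elim
      · intro h
        exact .inl ⟨z, q', hz, h⟩
    · have h1 := hY Y
      simp only [h, not_false_eq_true, true_and] at h1
      rcases em (E Y Y) with h2 | h2
      · rcases h1.1 h2 with ⟨z, q', h3, -⟩ | h3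
        · exact (h ⟨z, q', h3⟩).elim
        · exact (h3 h2).elim
      · exact (h2 (h1.2 (.inr h2))).elim
  · rintro ⟨z, hz, hY⟩
    obtain ⟨s, hs⟩ := hM.pairing z z
    obtain ⟨X, hX⟩ := hM.pairing s c
    have hsA : E s A₁ := (hA₁ s).2 ⟨z, hz, fun Z => by rw [hs, or_self]⟩
    have hXW : E X W := by
      refine (hW X).2 fun y hy => (hu' y).2 ?_
      rcases (hX y).1 hy with rfl | rfl
      · exact .inl hsA
      · exact .inr rfl
    have hXc : Code X z q := ⟨s, c, e, r, hX, hs, hc, he, hr⟩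
    refine ⟨X, hXW, fun Z => ?_⟩
    rw [hY, ← hQP]
    constructor
    · intro h
      exact .inl ⟨z, q, hXc, h⟩
    · rintro (⟨z', q', h1, h2⟩ | ⟨h1, -⟩)
      · obtain ⟨-, rfl⟩ := hcode X z' q' hXW h1
        obtain ⟨s', c1', e1', r1', j1, j2, j3, j4, j5⟩ := h1
        have : s = s' := by
          rcases (j1 s).1 ((hX s).2 (.inl rfl)) with h | h
          · exact h
          · exact (singleton_ne_tag hs j3 j4 j5 h).elim
        subst this
        obtain rfl := Pr.singleton_inj hs j2
        exact h2
      · exact (h1 ⟨z, q, hXc⟩).elim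

theorem StarModel.finite_replacement (hM : StarModel M) : ∀ {k : ℕ} (p : Fin k → M),
    StarReplacement p
  | 0, p => by
    intro P hP
    refine hM.replacement P ?_
    obtain ⟨φ, hφ⟩ := hP
    refine ⟨φ.restrictFreeVar (fun a => a.1.elim0), fun xs => ?_⟩
    rw [BoundedFormula.realize_restrictFreeVar p (fun a => a.1.elim0), hφ]
  | k + 1, p => by
    rw [← Fin.cons_self_tail p]
    exact hM.code_step _ _ (hM.finite_replacement _)

/-- Replacement* with parameters. -/
theorem StarModel.param_replacement (hM : StarModel M) (P : M → M → Prop)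
    [hP : Dfn id (fun xs : Fin 2 → M => P (xs 0) (xs 1))] (A : M) :
    ∃ B, ∀ Y, E Y B ↔ ∃ X, E X A ∧ ∀ Z, E Z Y ↔ P X Z := by
  obtain ⟨k, p, hp⟩ := hP.finite
  exact hM.finite_replacement p P hp A

end Star

/-! ### Separation up to co-extensionality, transitive closures and pure sets. -/

section Pure

variable {M : Type} [LSet.Structure M] {α : Type} {v : α → M} {n : ℕ}

/-- Co-extensionality. -/
def Coext (x y : M) : Prop := ∀ z, E z x ↔ E z y

instance Dfn.coext (s t : (Fin n → M) → M) [Tm v s] [Tm v t] :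
    Dfn v (fun xs => Coext (s xs) (t xs)) := by
  unfold Coext; infer_instance

theorem Coext.refl (x : M) : Coext x x := fun _ => Iff.rfl
theorem Coext.symm {x y : M} (h : Coext x y) : Coext y x := fun z => (h z).symm
theorem Coext.trans {x y z : M} (h : Coext x y) (h' : Coext y z) : Coext x z :=
  fun w => (h w).trans (h' w)

/-- `y` is closed under co-extensionality. -/
def Closed (y : M) : Prop := ∀ m n, Coext m n → (E m y ↔ E n y)

instance Dfn.closed (s : (Fin n → M) → M) [Tm v s] : Dfn v (fun xs => Closed (s xs)) := by
  unfold Closed; infer_instance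

def Incl (x y : M) : Prop := ∀ z, E z x → E z y

instance Dfn.incl (s t : (Fin n → M) → M) [Tm v s] [Tm v t] :
    Dfn v (fun xs => Incl (s xs) (t xs)) := by
  unfold Incl; infer_instance

def MemTrans (x : M) : Prop := ∀ z, E z x → Incl z x

instance Dfn.memTrans (s : (Fin n → M) → M) [Tm v s] : Dfn v (fun xs => MemTrans (s xs)) := by
  unfold MemTrans; infer_instance

/-- `t` is a transitive pure set. -/
def Good (t : M) : Prop := Closed t ∧ MemTrans t ∧ ∀ z, E z t → Closed z

instance Dfn.good (s : (Fin n → M) → M) [Tm v s] : Dfn v (fun xs => Good (s xs)) := by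
  unfold Good; infer_instance

/-- `x` is a pure set (see `StarModel.pure_iff`). -/
def Pure (x : M) : Prop := Closed x ∧ ∃ t, Good t ∧ Incl x t

instance Dfn.pure (s : (Fin n → M) → M) [Tm v s] : Dfn v (fun xs => Pure (s xs)) := by
  unfold Pure; infer_instance

theorem Closed.congr {x y : M} (h : Closed x) (e : Coext x y) : Closed y :=
  fun m n hmn => by rw [← e, ← e]; exact h m n hmn

theorem Pure.congr {x y : M} (h : Pure x) (e : Coext x y) : Pure y := by
  obtain ⟨hx, t, ht, hxt⟩ := h
  exact ⟨hx.congr e, t, ht, fun z hz => hxt z ((e z).2 hz)⟩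

theorem Pure.mem {x y : M} (h : Pure x) (hy : E y x) : Pure y := by
  obtain ⟨hx, t, ht, hxt⟩ := h
  exact ⟨ht.2.2 y (hxt y hy), t, ht, ht.2.1 y (hxt y hy)⟩

/-- The class of all variants of elements of `A` that satisfy a predicate. -/
theorem StarModel.sep' (hM : StarModel M) (P : M → Prop)
    [hP : Dfn id (fun xs : Fin 1 → M => P (xs 0))] (A : M) :
    ∃ B, Closed B ∧ ∀ y, E y B ↔ ∃ x, E x A ∧ P x ∧ Coext x y := by
  have := fun {n} (t : (Fin n → M) → M) [Tm id t] => Dfn.comp₁ hP t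
  -- An `X` in `P` is sent to its own extension, which all its variants share; any other `X` is sent
  -- to the nonexistent Russell class.
  obtain ⟨B, hB⟩ := hM.param_replacement
    (fun X Z => (P X ∧ E Z X) ∨ (¬ P X ∧ ¬ E Z Z)) A
  have key : ∀ y, E y B ↔ ∃ x, E x A ∧ P x ∧ Coext x y := by
    intro y
    rw [hB]
    refine exists_congr fun x => and_congr_right fun _ => ?_
    by_cases h : P x
    · simp only [h, true_and, not_true_eq_false, false_and, or_false]
      exact ⟨fun h z => (h z).symm, fun h z => (h z).symm⟩
    · simp only [h, false_and, not_false_eq_true, true_and, false_or, iff_false, not_forall]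
      exact ⟨y, fun h => (iff_not_self h).elim⟩
  refine ⟨B, fun m n h => ?_, key⟩
  rw [key, key]
  exact exists_congr fun x => and_congr_right fun _ => and_congr_right fun _ =>
    ⟨fun h' => h'.trans h, fun h' => h'.trans h.symm⟩

theorem StarModel.closure (hM : StarModel M) (A : M) :
    ∃ B, Closed B ∧ ∀ y, E y B ↔ ∃ x, E x A ∧ Coext x y := by
  obtain ⟨B, h, hB⟩ := hM.sep' (fun x => x = x) A
  exact ⟨B, h, by simpa using hB⟩

/-- Separation for classes that are closed under co-extensionality. -/
theorem StarModel.sep (hM : StarModel M) (P : M → Prop)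
    [Dfn id (fun xs : Fin 1 → M => P (xs 0))] {A : M} (hA : Closed A)
    (hP : ∀ x y, E x A → Coext x y → P x → P y) :
    ∃ B, Closed B ∧ ∀ y, E y B ↔ E y A ∧ P y := by
  obtain ⟨B, h, hB⟩ := hM.sep' P A
  refine ⟨B, h, fun y => ?_⟩
  rw [hB]
  constructor
  · rintro ⟨x, hx, hPx, hxy⟩
    exact ⟨(hA x y hxy).1 hx, hP x y hx hxy hPx⟩
  · rintro ⟨hy, hPy⟩
    exact ⟨y, hy, hPy, Coext.refl y⟩

theorem StarModel.binary_union (hM : StarModel M) (a b : M) : ∃ x, ∀ y, E y x ↔ E y a ∨ E y b := by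
  obtain ⟨p, hp⟩ := hM.pairing a b
  obtain ⟨x, hx⟩ := hM.union p
  refine ⟨x, fun y => ?_⟩
  rw [hx]
  constructor
  · rintro ⟨z, hz, hy⟩
    rcases (hp z).1 hz with rfl | rfl
    exacts [.inl hy, .inr hy]
  · rintro (h | h)
    exacts [⟨a, (hp a).2 (.inl rfl), h⟩, ⟨b, (hp b).2 (.inr rfl), h⟩]

/-- The closed class of variants of elements of `a` and of `b` itself. -/
theorem StarModel.insert (hM : StarModel M) {a : M} (ha : Closed a) (b : M) :
    ∃ x, Closed x ∧ ∀ y, E y x ↔ E y a ∨ Coext b y := by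
  obtain ⟨p, hp⟩ := hM.pairing b b
  obtain ⟨u, hu⟩ := hM.binary_union a p
  obtain ⟨x, hx, hx'⟩ := hM.closure u
  refine ⟨x, hx, fun y => ?_⟩
  rw [hx']
  constructor
  · rintro ⟨z, hz, hzy⟩
    rcases (hu z).1 hz with h | h
    · exact .inl ((ha z y hzy).1 h)
    · obtain rfl : z = b := by simpa using (hp z).1 h
      exact .inr hzy
  · rintro (h | h)
    · exact ⟨y, (hu y).2 (.inl h), Coext.refl y⟩
    · exact ⟨b, (hu b).2 (.inr ((hp b).2 (.inl rfl))), h⟩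

/-- `t` is a transitive closure of `x`. -/
def IsTC (x t : M) : Prop :=
  Incl x t ∧ MemTrans t ∧ ∀ s, Incl x s → MemTrans s → Incl t s

theorem StarModel.tc_step (hM : StarModel M) {x t : M} (h : Incl x t) (ht : MemTrans t) :
    ∃ s, (∀ y, E y s ↔ E y x ∨ ∃ z, E z t ∧ E y z) ∧ Incl x s ∧ MemTrans s := by
  obtain ⟨u, hu⟩ := hM.union t
  obtain ⟨s, hs⟩ := hM.binary_union x u
  simp only [hu] at hs
  refine ⟨s, hs, fun z hz => (hs z).2 (.inl hz), fun z hz w hw => (hs w).2 (.inr ⟨z, ?_, hw⟩)⟩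
  rcases (hs z).1 hz with h' | ⟨y, hy, hzy⟩
  exacts [h z h', ht y hy z hzy]

/-- By leastness, `t` is included in the transitive class formed by `x` and the union of `t`. So
each element of `t` lies in `x` or in an element of `t`; both are closed and included in `t`. -/
theorem StarModel.good_of_isTC (hM : StarModel M) {x t : M} (hx : Closed x) (h : IsTC x t)
    (ht : ∀ z, E z t → Closed z) : Good t := by
  refine ⟨?_, h.2.1, ht⟩
  obtain ⟨s, hs, hxs, hst⟩ := hM.tc_step h.1 h.2.1
  have key : ∀ m n, Coext m n → E m t → E n t := by
    intro m n hmn hm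
    rcases (hs m).1 (h.2.2 s hxs hst m hm) with h' | ⟨z, hz, hmz⟩
    · exact h.1 n ((hx m n hmn).1 h')
    · exact h.2.1 z hz n ((ht z hz m n hmn).1 hmz)
  exact fun m n hmn => ⟨key m n hmn, key n m hmn.symm⟩

/-- The closure is cut out of `t` as the intersection of the transitive classes that include `x`.
Only closed classes are intersected, so that the predicate is invariant under co-extensionality and
`sep` applies. -/
theorem StarModel.exists_isTC (hM : StarModel M) {x t : M} (hx : Closed x) (ht : Good t)
    (hxt : Incl x t) : ∃ T, IsTC x T ∧ Incl T t := by
  obtain ⟨T, hTc, hT⟩ := hM.sep (fun z => ∀ s, Closed s → MemTrans s → Incl x s → E z s) ht.1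
    (fun z w _ e h s h1 h2 h3 => (h1 z w e).1 (h s h1 h2 h3))
  have hTt : MemTrans T := by
    intro z hz w hw
    rw [hT] at hz ⊢
    exact ⟨ht.2.1 z hz.1 w hw, fun s h1 h2 h3 => h2 z (hz.2 s h1 h2 h3) w hw⟩
  have hxT : Incl x T := fun z hz => (hT z).2 ⟨hxt z hz, fun s _ _ h => h z hz⟩
  refine ⟨T, ⟨hxT, hTt, fun s hxs hs => ?_⟩, fun z hz => ((hT z).1 hz).1⟩
  -- An arbitrary transitive `s` need not be closed; it is compared through its closed core, the
  -- elements of `T` all of whose variants lie in `s`.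
  obtain ⟨s', hsc, hs'⟩ := hM.sep (fun z => ∀ w, Coext z w → E w s) hTc
    (fun z w _ e h y hy => h y (e.trans hy))
  have h1 : Incl T s' := by
    intro z hz
    refine ((hT z).1 hz).2 s' hsc ?_ ?_
    · intro y hy w hw
      have hy' := (hs' y).1 hy
      refine (hs' w).2 ⟨hTt y hy'.1 w hw, fun w' e => ?_⟩
      exact hs y (hy'.2 y (Coext.refl y)) w'
        ((ht.2.2 y ((hT y).1 hy'.1).1 w w' e).1 hw)
    · intro y hy
      exact (hs' y).2 ⟨hxT y hy, fun w e => hxs w ((hx y w e).1 hy)⟩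
  exact fun z hz => ((hs' z).1 (h1 z hz)).2 z (Coext.refl z)

/-- Links the defining formula, which asks for a least transitive class, to `Pure`, which asks only
for some transitive pure set around `x`. -/
theorem StarModel.pure_iff (hM : StarModel M) (x : M) :
    Closed x ∧ (∃ t, IsTC x t ∧ ∀ z, E z t → Closed z) ↔ Pure x := by
  refine and_congr_right fun hx => ⟨?_, ?_⟩
  · rintro ⟨t, h, ht⟩
    exact ⟨t, hM.good_of_isTC hx h ht, h.1⟩
  · rintro ⟨t, ht, hxt⟩
    obtain ⟨T, hT, hTt⟩ := hM.exists_isTC hx ht hxt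
    exact ⟨T, hT, fun z hz => ht.2.2 z (hTt z hz)⟩

/-- A set of pure sets is pure. -/
theorem StarModel.pure_of_forall_mem (hM : StarModel M) {x : M} (hx : Closed x)
    (h : ∀ y, E y x → Pure y) : Pure x := by
  -- Each `X` is sent to the intersection of all transitive pure sets that include it. This is
  -- definable, so no closure has to be chosen. The union of these values together with `x` is the
  -- required transitive pure set.
  obtain ⟨B, hB⟩ := hM.param_replacement (fun X Z => ∀ t, Good t → Incl X t → E Z t) x
  have hgood : ∀ Y, E Y B → Good Y := by
    intro Y hY
    obtain ⟨X, hX, hXY⟩ := (hB Y).1 hY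
    obtain ⟨-, t, ht, hXt⟩ := h X hX
    refine ⟨fun m n e => ?_, fun z hz w hw => ?_, fun z hz => ht.2.2 z ((hXY z).1 hz t ht hXt)⟩
    · rw [hXY, hXY]
      exact forall_congr' fun t => imp_congr_right fun ht => imp_congr_right fun _ => ht.1 m n e
    · rw [hXY] at hz ⊢
      exact fun s h1 h2 => h1.2.1 z (hz s h1 h2) w hw
  have hex : ∀ X, E X x → ∃ Y, E Y B ∧ Incl X Y := by
    intro X hX
    obtain ⟨-, t, ht, hXt⟩ := h X hX
    obtain ⟨Y, -, hY⟩ := hM.sep (fun Z => ∀ t, Good t → Incl X t → E Z t) ht.1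
      (fun z w _ e h s h1 h2 => (h1.1 z w e).1 (h s h1 h2))
    refine ⟨Y, (hB Y).2 ⟨X, hX, fun Z => ?_⟩, fun z hz => (hY z).2 ⟨hXt z hz, fun t _ h => h z hz⟩⟩
    rw [hY]
    exact ⟨fun h => h.2, fun h => ⟨h t ht hXt, h⟩⟩
  obtain ⟨u, hu⟩ := hM.union B
  obtain ⟨t, ht⟩ := hM.binary_union x u
  refine ⟨hx, t, ⟨?_, ?_, ?_⟩, fun z hz => (ht z).2 (.inl hz)⟩
  · have huc : Closed u := fun m n e => by
      rw [hu, hu]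
      exact exists_congr fun z => and_congr_right fun hz => (hgood z hz).1 m n e
    intro m n e
    rw [ht, ht, hx m n e, huc m n e]
  · intro z hz w hw
    refine (ht w).2 (.inr ((hu w).2 ?_))
    rcases (ht z).1 hz with h' | h'
    · obtain ⟨Y, hY, hzY⟩ := hex z h'
      exact ⟨Y, hY, hzY w hw⟩
    · obtain ⟨Y, hY, hzY⟩ := (hu z).1 h'
      exact ⟨Y, hY, (hgood Y hY).2.1 z hzY w hw⟩
  · intro z hz
    rcases (ht z).1 hz with h' | h'
    · exact (h z h').1
    · obtain ⟨Y, hY, hzY⟩ := (hu z).1 h'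
      exact (hgood Y hY).2.2 z hzY

end Pure

/-! ### An inductive set of pure sets, by bisimulation with the given inductive class. -/

section Infinity

variable {M : Type} [LSet.Structure M] {α : Type} {v : α → M} {n : ℕ}

/-- `p` is an ordered pair `(a, b)`. -/
def OP (p a b : M) : Prop := ∃ s c, Pr s a a ∧ Pr c a b ∧ Pr p s c

instance Dfn.op (r s t : (Fin n → M) → M) [Tm v r] [Tm v s] [Tm v t] :
    Dfn v (fun xs => OP (r xs) (s xs) (t xs)) := by
  unfold OP; infer_instance

theorem OP.inj {p a b a' b' : M} (h : OP p a b) (h' : OP p a' b') : a = a' ∧ b = b' := by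
  obtain ⟨s, c, hs, hc, hp⟩ := h
  obtain ⟨s', c', hs', hc', hp'⟩ := h'
  simp only [Pr] at hs hc hp hs' hc' hp'
  have ha : a = a' := by
    have : E a' s := by
      rcases (hp' s).1 ((hp s).2 (.inl rfl)) with h | h
      · rw [h, hs']; simp
      · rw [h, hc']; simp
    exact (by simpa using (hs a').1 this : a' = a).symm
  subst ha
  refine ⟨rfl, ?_⟩
  have h1 : b = a ∨ b = b' := by
    have hb : E b c := (hc b).2 (.inr rfl)
    rcases (hp' c).1 ((hp c).2 (.inr rfl)) with h | h
    · rw [h, hs'] at hb; left; simpa using hb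
    · rwa [h, hc'] at hb
  have h2 : b' = a ∨ b' = b := by
    have hb : E b' c' := (hc' b').2 (.inr rfl)
    rcases (hp c').1 ((hp' c').2 (.inr rfl)) with h | h
    · rw [h, hs] at hb; left; simpa using hb
    · rwa [h, hc] at hb
  rcases h1 with rfl | h1
  · rcases h2 with h2 | h2 <;> exact h2.symm
  · exact h1

/-- `(a, b) ∈ G` -/
def Maps (G a b : M) : Prop := ∃ p, E p G ∧ OP p a b

instance Dfn.maps (r s t : (Fin n → M) → M) [Tm v r] [Tm v s] [Tm v t] :
    Dfn v (fun xs => Maps (r xs) (s xs) (t xs)) := by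
  unfold Maps; infer_instance

theorem StarModel.exists_op (hM : StarModel M) (a b : M) : ∃ p, OP p a b := by
  obtain ⟨s, hs⟩ := hM.pairing a a
  obtain ⟨c, hc⟩ := hM.pairing a b
  obtain ⟨p, hp⟩ := hM.pairing s c
  exact ⟨p, s, c, hs, hc, hp⟩

theorem StarModel.add_pair (hM : StarModel M) (G a b : M) :
    ∃ G', ∀ x y, Maps G' x y ↔ Maps G x y ∨ (x = a ∧ y = b) := by
  obtain ⟨p, hp⟩ := hM.exists_op a b
  obtain ⟨s, hs⟩ := hM.pairing p p
  obtain ⟨G', hG'⟩ := hM.binary_union G s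
  refine ⟨G', fun x y => ⟨?_, ?_⟩⟩
  · rintro ⟨q, hq, hqxy⟩
    rcases (hG' q).1 hq with h | h
    · exact .inl ⟨q, h, hqxy⟩
    · obtain rfl : q = p := by simpa using (hs q).1 h
      exact .inr (hqxy.inj hp)
  · rintro (⟨q, hq, h⟩ | ⟨rfl, rfl⟩)
    · exact ⟨q, (hG' q).2 (.inl hq), h⟩
    · exact ⟨p, (hG' p).2 (.inr ((hs p).2 (.inl rfl))), hp⟩

/-- `G` is a bisimulation between pure sets (up to co-extensionality) and classes. -/
def IsBisim (G : M) : Prop := ∀ a b, Maps G a b →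
  (∀ x, E x a → ∃ y, E y b ∧ ∃ x', Coext x x' ∧ Maps G x' y) ∧
  (∀ y, E y b → ∃ x, E x a ∧ Maps G x y)

instance Dfn.isBisim (s : (Fin n → M) → M) [Tm v s] : Dfn v (fun xs => IsBisim (s xs)) := by
  unfold IsBisim; infer_instance

def Bisim (k m : M) : Prop := ∃ G, IsBisim G ∧ Maps G k m

instance Dfn.bisim (s t : (Fin n → M) → M) [Tm v s] [Tm v t] :
    Dfn v (fun xs => Bisim (s xs) (t xs)) := by
  unfold Bisim; infer_instance

theorem Bisim.left {k m x : M} (h : Bisim k m) (hx : E x k) :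
    ∃ y, E y m ∧ ∃ x', Coext x x' ∧ Bisim x' y := by
  obtain ⟨G, hG, hkm⟩ := h
  obtain ⟨y, hy, x', e, h⟩ := (hG k m hkm).1 x hx
  exact ⟨y, hy, x', e, G, hG, h⟩

theorem Bisim.right {k m y : M} (h : Bisim k m) (hy : E y m) : ∃ x, E x k ∧ Bisim x y := by
  obtain ⟨G, hG, hkm⟩ := h
  obtain ⟨x, hx, h⟩ := (hG k m hkm).2 y hy
  exact ⟨x, hx, G, hG, h⟩

theorem StarModel.bisim_empty (hM : StarModel M) {k m : M} (hk : ∀ y, ¬ E y k)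
    (hm : ∀ y, ¬ E y m) : Bisim k m := by
  obtain ⟨G, hG⟩ := hM.add_pair k k m
  have hG : ∀ x y, Maps G x y ↔ x = k ∧ y = m := by
    intro x y
    rw [hG, or_iff_right]
    rintro ⟨p, hp, -⟩
    exact hk p hp
  refine ⟨G, fun a b hab => ?_, (hG k m).2 ⟨rfl, rfl⟩⟩
  obtain ⟨rfl, rfl⟩ := (hG a b).1 hab
  exact ⟨fun x hx => (hk x hx).elim, fun y hy => (hm y hy).elim⟩

/-- One new pair `(k', m')` suffices. The variants of `k` in `k'` are matched with `m` through `k`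
itself, which is why `IsBisim` allows a variant `x'` in its first clause. -/
theorem StarModel.bisim_succ (hM : StarModel M) {k m k' m' : M} (h : Bisim k m)
    (hk : ∀ y, E y k' ↔ E y k ∨ Coext k y) (hm : ∀ y, E y m' ↔ E y m ∨ y = m) : Bisim k' m' := by
  obtain ⟨G, hG, hkm⟩ := h
  obtain ⟨G', hG'⟩ := hM.add_pair G k' m'
  refine ⟨G', fun a b hab => ?_, (hG' _ _).2 (.inr ⟨rfl, rfl⟩)⟩
  have key : ∀ a b, Maps G a b → (∀ x, E x a → ∃ y, E y b ∧ ∃ x', Coext x x' ∧ Maps G' x' y) ∧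
      (∀ y, E y b → ∃ x, E x a ∧ Maps G' x y) := by
    intro a b h
    constructor
    · intro x hx
      obtain ⟨y, hy, x', e, h'⟩ := (hG a b h).1 x hx
      exact ⟨y, hy, x', e, (hG' _ _).2 (.inl h')⟩
    · intro y hy
      obtain ⟨x, hx, h'⟩ := (hG a b h).2 y hy
      exact ⟨x, hx, (hG' _ _).2 (.inl h')⟩
  rcases (hG' a b).1 hab with h | ⟨rfl, rfl⟩
  · exact key a b h
  · constructor
    · intro x hx
      rcases (hk x).1 hx with h | h
      · obtain ⟨y, hy, h'⟩ := (key k m hkm).1 x h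
        exact ⟨y, (hm y).2 (.inl hy), h'⟩
      · exact ⟨m, (hm m).2 (.inr rfl), k, h.symm, (hG' _ _).2 (.inl hkm)⟩
    · intro y hy
      rcases (hm y).1 hy with h | rfl
      · obtain ⟨x, hx, h'⟩ := (key k m hkm).2 y h
        exact ⟨x, (hk x).2 (.inl hx), h'⟩
      · exact ⟨k, (hk k).2 (.inr (Coext.refl k)), (hG' _ _).2 (.inl hkm)⟩

/-- `k` is a well-founded pure set. -/
def WFPure (k : M) : Prop := ∃ t, Good t ∧ E k t ∧
  ∀ s, Closed s → Incl s t → (∃ y, E y s) → ∃ y, E y s ∧ ∀ z, E z s → ¬ E z y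

instance Dfn.wfPure (s : (Fin n → M) → M) [Tm v s] : Dfn v (fun xs => WFPure (s xs)) := by
  unfold WFPure; infer_instance

theorem WFPure.pure {k : M} (h : WFPure k) : Pure k := by
  obtain ⟨t, ht, hk, -⟩ := h
  exact ⟨ht.2.2 k hk, t, ht, ht.2.1 k hk⟩

theorem WFPure.congr {k k' : M} (h : WFPure k) (e : Coext k k') : WFPure k' := by
  obtain ⟨t, ht, hk, h⟩ := h
  exact ⟨t, ht, (ht.1 k k' e).1 hk, h⟩

/-- Add the variants of `k` to `t`. If `s` meets `t`, a minimal element of the intersection is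
minimal in `s`, as `t` is transitive. Otherwise `s` consists of variants of `k`, whose elements lie
in `t`, and any of them is minimal. -/
theorem StarModel.wfPure_of_insert (hM : StarModel M) {t k : M} (ht : Good t)
    (hwf : ∀ s, Closed s → Incl s t → (∃ y, E y s) → ∃ y, E y s ∧ ∀ z, E z s → ¬ E z y)
    (hk : Closed k) (hkt : Incl k t) : WFPure k := by
  obtain ⟨u, hu, hu'⟩ := hM.insert ht.1 k
  by_cases hkt' : E k t
  · exact ⟨t, ht, hkt', hwf⟩
  refine ⟨u, ⟨hu, fun z hz w hw => ?_, fun z hz => ?_⟩, (hu' k).2 (.inr (Coext.refl k)), ?_⟩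
  · refine (hu' w).2 (.inl ?_)
    rcases (hu' z).1 hz with h | h
    exacts [ht.2.1 z h w hw, hkt w ((h w).2 hw)]
  · rcases (hu' z).1 hz with h | h
    exacts [ht.2.2 z h, hk.congr h]
  · rintro s hs hsu ⟨y, hy⟩
    obtain ⟨s', hsc, hs'⟩ := hM.sep (fun y => E y t) hs (fun x y _ e h => (ht.1 x y e).1 h)
    by_cases hne : ∃ y, E y s'
    · obtain ⟨y, hy, h⟩ := hwf s' hsc (fun z hz => ((hs' z).1 hz).2) hne
      refine ⟨y, ((hs' y).1 hy).1, fun z hz hzy => h z ((hs' z).2 ⟨hz, ?_⟩) hzy⟩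
      exact ht.2.1 y ((hs' y).1 hy).2 z hzy
    · have hs'' : ∀ z, E z s → ¬ E z t := fun z hz hzt => hne ⟨z, (hs' z).2 ⟨hz, hzt⟩⟩
      refine ⟨y, hy, fun z hz hzy => hs'' z hz ?_⟩
      rcases (hu' y).1 (hsu y hy) with h | h
      · exact ht.2.1 y h z hzy
      · exact hkt z ((h z).2 hzy)

theorem StarModel.wfPure_succ (hM : StarModel M) {k k' : M} (h : WFPure k) (hc : Closed k')
    (hk : ∀ y, E y k' ↔ E y k ∨ Coext k y) : WFPure k' := by
  obtain ⟨t, ht, hkt, hwf⟩ := h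
  refine hM.wfPure_of_insert ht hwf hc fun z hz => ?_
  rcases (hk z).1 hz with h | h
  exacts [ht.2.1 k hkt z h, (ht.1 k z h).1 hkt]

/-- Take a minimal counterexample `z` in `t`. Elements of `z` and `k'` that are matched with the
same element of `m` are co-extensional by minimality; since `z` and `k'` are closed, they have the
same elements. -/
theorem StarModel.bisim_unique (hM : StarModel M) {k k' m : M} (hk : WFPure k) (hk' : Pure k')
    (h : Bisim k m) (h' : Bisim k' m) : Coext k k' := by
  obtain ⟨t, ht, hkt, hwf⟩ := hk
  by_contra hne
  -- `m` and `k'` are quantified so that minimality applies to the elements of `z`; passing to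
  -- variants makes `s` closed, as well-foundedness of `t` requires.
  obtain ⟨s, hsc, hs⟩ := hM.sep' (fun z : M => ∃ m k' : M, Pure k' ∧ Bisim z m ∧ Bisim k' m ∧ ¬ Coext z k') t
  obtain ⟨z', hz', hmin⟩ := hwf s hsc (by
    intro z hz
    obtain ⟨x, hx, -, e⟩ := (hs z).1 hz
    exact (ht.1 x z e).1 hx) ⟨k, (hs k).2 ⟨k, hkt, ⟨m, k', hk', h, h', hne⟩, Coext.refl k⟩⟩
  obtain ⟨z, hz, ⟨m, k', hk', h, h', hne⟩, e⟩ := (hs z').1 hz'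
  have key : ∀ w x m u, E x z → Coext x w → Pure u → Bisim w m → Bisim u m → Coext x u := by
    intro w x m u hx hxw hu h1 h2
    by_contra hxu
    refine hmin x ((hs x).2 ⟨w, (ht.1 x w hxw).1 (ht.2.1 z hz x hx),
      ⟨m, u, hu, h1, h2, fun h => hxu (hxw.trans h)⟩, hxw.symm⟩) ((e x).1 hx)
  refine hne fun w => ⟨fun hw => ?_, fun hw => ?_⟩
  · obtain ⟨y, hy, w', e', h1⟩ := h.left hw
    obtain ⟨u, hu, h2⟩ := h'.right hy
    exact (hk'.1 w u (key w' w y u hw e' (hk'.mem hu) h1 h2)).2 hu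
  · obtain ⟨y, hy, w', e', h1⟩ := h'.left hw
    obtain ⟨u, hu, h2⟩ := h.right hy
    have := key u u y w' hu (Coext.refl u) ((hk'.mem hw).congr e') h2 h1
    exact (ht.2.2 z hz u w (this.trans e'.symm)).1 hu

theorem StarModel.exists_empty (hM : StarModel M) : ∃ e : M, ∀ z, ¬ E z e := by
  obtain ⟨N, ⟨e, -, he⟩, -⟩ := hM.infinity
  exact ⟨e, he⟩

theorem StarModel.wfPure_empty (hM : StarModel M) {e : M} (he : ∀ z, ¬ E z e) : WFPure e := by
  have hc : ∀ x : M, (∀ z, ¬ E z x) → Closed x := fun x hx m n _ => by simp [hx]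
  refine hM.wfPure_of_insert (t := e) ⟨hc e he, fun z hz => (he z hz).elim,
    fun z hz => (he z hz).elim⟩ ?_ (hc e he) fun z hz => hz
  rintro s - hs ⟨y, hy⟩
  exact (he y (hs y hy)).elim

/-- There is an inductive set of pure sets. -/
theorem StarModel.pure_infinity (hM : StarModel M) : ∃ I : M, Closed I ∧ (∀ k, E k I → Pure k) ∧
    (∀ e, (∀ z, ¬ E z e) → E e I) ∧
    ∀ k k', E k I → Closed k' → (∀ y, E y k' ↔ E y k ∨ Coext k y) → E k' I := by
  obtain ⟨N, ⟨e, heN, he⟩, hsucc⟩ := hM.infinity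
  -- `X` is sent to the well-founded pure set bisimilar to it. An `X` without such a partner is sent
  -- to the empty class, which is harmless because the empty element `e` of `N` has that value too.
  obtain ⟨I₀, hI₀⟩ := hM.param_replacement (fun X Z => ∃ k, WFPure k ∧ Bisim k X ∧ E Z k) N
  have hval : ∀ k X : M, WFPure k → Bisim k X → ∀ Z, (∃ k, WFPure k ∧ Bisim k X ∧ E Z k) ↔ E Z k := by
    intro k X hk h Z
    constructor
    · rintro ⟨k', hk', h', hZ⟩
      exact (hM.bisim_unique hk hk'.pure h h' Z).2 hZ
    · exact fun hZ => ⟨k, hk, h, hZ⟩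
  have hI : ∀ k, E k I₀ ↔ WFPure k ∧ ∃ X k', E X N ∧ Coext k k' ∧ WFPure k' ∧ Bisim k' X := by
    intro k
    rw [hI₀]
    constructor
    · rintro ⟨X, hX, h⟩
      by_cases h' : ∃ k, WFPure k ∧ Bisim k X
      · obtain ⟨k', hk', hb⟩ := h'
        have e : Coext k k' := fun Z => (h Z).trans (hval k' X hk' hb Z)
        exact ⟨hk'.congr e.symm, X, k', hX, e, hk', hb⟩
      · have hk : ∀ z, ¬ E z k := by
          intro z hz
          obtain ⟨k', h1, h2, -⟩ := (h z).1 hz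
          exact h' ⟨k', h1, h2⟩
        exact ⟨hM.wfPure_empty hk, e, k, heN, Coext.refl k, hM.wfPure_empty hk,
          hM.bisim_empty hk he⟩
    · rintro ⟨-, X, k', hX, e, hk', hb⟩
      exact ⟨X, hX, fun Z => (e Z).trans (hval k' X hk' hb Z).symm⟩
  refine ⟨I₀, fun m n e => ?_, fun k hk => ((hI k).1 hk).1.pure, fun x hx => ?_, ?_⟩
  · rw [hI₀, hI₀]
    exact exists_congr fun X => and_congr_right fun _ => forall_congr' fun Z => by rw [e]
  · exact (hI x).2 ⟨hM.wfPure_empty hx, e, x, heN, Coext.refl x, hM.wfPure_empty hx,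
      hM.bisim_empty hx he⟩
  · intro k k' hk hc hk'
    obtain ⟨h1, X, l, hX, e, hl, hb⟩ := (hI k).1 hk
    obtain ⟨Y, hY, hXY⟩ := hsucc X hX
    have hw := hM.wfPure_succ h1 hc hk'
    refine (hI k').2 ⟨hw, Y, k', hY, Coext.refl k', hw, hM.bisim_succ hb (fun y => ?_) hXY⟩
    rw [hk', e y]
    exact or_congr_right ⟨fun h => e.symm.trans h, fun h => e.trans h⟩

end Infinity

/-! ### Models of ZF -/

section ZFModels

/-- Models of ZF without Foundation. -/
structure ZFModel (U : Type) [LSet.Structure U] : Prop where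
  ext : ∀ x y : U, (∀ z, E z x ↔ E z y) → x = y
  pairing : ∀ a b : U, ∃ x, ∀ y, E y x ↔ y = a ∨ y = b
  union : ∀ a : U, ∃ x, ∀ y, E y x ↔ ∃ z, E z a ∧ E y z
  power : ∀ a : U, ∃ x, ∀ y, E y x ↔ ∀ z, E z y → E z a
  infinity : ∃ N : U, (∃ e, E e N ∧ ∀ z, ¬ E z e) ∧
    ∀ x, E x N → ∃ m, E m N ∧ ∀ y, E y m ↔ E y x ∨ y = x
  sep : ∀ P : U → Prop, Dfn id (fun xs : Fin 1 → U => P (xs 0)) →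
    ∀ A, ∃ x, ∀ y, E y x ↔ E y A ∧ P y
  repl : ∀ R : U → U → Prop, Dfn id (fun xs : Fin 2 → U => R (xs 0) (xs 1)) →
    ∀ A, (∀ x, E x A → ∃ k, ∀ y, R x y ↔ y = k) → ∃ B, ∀ y, E y B ↔ ∃ x, E x A ∧ R x y

/-- The axiom of Foundation. -/
def Founded (U : Type) [LSet.Structure U] : Prop :=
  ∀ A : U, (∃ x, E x A) → ∃ y, E y A ∧ ¬ ∃ z, E z A ∧ E z y

variable {U : Type} [LSet.Structure U]

@[simp] theorem realize_bvar {α : Type} {n : ℕ} (i : Fin n) (v : α → U) (xs : Fin n → U) :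
    (&i : LSet.Term (α ⊕ Fin n)).realize (Sum.elim v xs) = xs i := rfl

theorem realize_extensionality :
    U ⊨ extensionality ↔ ∀ x y : U, (∀ z, E z x ↔ E z y) → x = y := by
  simp [extensionality, Sentence.Realize, Formula.Realize, Fin.snoc]

theorem realize_foundation : U ⊨ foundation ↔ Founded U := by
  simp [foundation, Founded, Sentence.Realize, Formula.Realize, Fin.snoc]

theorem realize_pairing :
    U ⊨ pairing ↔ ∀ a b : U, ∃ x, ∀ y, E y x ↔ y = a ∨ y = b := by
  simp [pairing, Sentence.Realize, Formula.Realize, Fin.snoc]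

theorem realize_union :
    U ⊨ union ↔ ∀ a : U, ∃ x, ∀ y, E y x ↔ ∃ z, E z a ∧ E y z := by
  simp [union, Sentence.Realize, Formula.Realize, Fin.snoc]

theorem realize_power :
    U ⊨ power ↔ ∀ a : U, ∃ x, ∀ y, E y x ↔ ∀ z, E z y → E z a := by
  simp [power, Sentence.Realize, Formula.Realize, Fin.snoc]

theorem realize_infinity :
    U ⊨ infinity ↔ ∃ N : U, (∃ e, E e N ∧ ∀ z, ¬ E z e) ∧
      ∀ x, E x N → ∃ m, E m N ∧ ∀ y, E y m ↔ E y x ∨ y = x := by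
  simp [infinity, Sentence.Realize, Formula.Realize, Fin.snoc]

theorem realize_replacementStar (φ : LSet.Formula (Fin 2)) :
    U ⊨ replacementStar φ ↔ ∀ A : U, ∃ B, ∀ Y, E Y B ↔ ∃ X, E X A ∧
      ∀ Z, E Z Y ↔ φ.Realize ![X, Z] := by
  have h : ∀ (A B Y X Z : U) (v : Empty → U), (fun b => ((![&3, &4] : Fin 2 → LSet.Term
      (Empty ⊕ Fin 5)) b).realize (Sum.elim v ![A, B, Y, X, Z])) = ![X, Z] := by
    intro A B Y X Z v
    funext i; fin_cases i <;> rfl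
  have hs : ∀ A B Y X Z : U, (Fin.snoc (Fin.snoc (Fin.snoc (Fin.snoc
      (Fin.snoc (default : Fin 0 → U) A : Fin 1 → U) B : Fin 2 → U) Y : Fin 3 → U) X : Fin 4 → U) Z
      : Fin 5 → U) = ![A, B, Y, X, Z] := by
    intro A B Y X Z
    funext i; fin_cases i <;> rfl
  simp only [replacementStar, Sentence.Realize, Formula.Realize, BoundedFormula.realize_all,
    BoundedFormula.realize_ex, BoundedFormula.realize_iff, BoundedFormula.realize_inf,
    realize_memF, realize_app, realize_bvar]
  simp only [hs, h]
  rfl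

theorem realize_separation {n : ℕ} (φ : LSet.Formula (Fin n ⊕ Fin 1)) :
    U ⊨ separation φ ↔ ∀ (p : Fin n → U) (A : U), ∃ x, ∀ y, E y x ↔ E y A ∧
      φ.Realize (Sum.elim p (fun _ => y)) := by
  unfold separation
  rw [realize_close]
  refine forall_congr' fun p => ?_
  simp only [Formula.Realize, BoundedFormula.realize_all, BoundedFormula.realize_ex,
    BoundedFormula.realize_iff, BoundedFormula.realize_inf, realize_memF, realize_app,
    realize_bvar]
  refine forall_congr' fun A => exists_congr fun x => forall_congr' fun y =>
    iff_congr Iff.rfl (and_congr Iff.rfl (iff_of_eq (congrArg (fun w => φ.Realize w) ?_)))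
  funext b
  rcases b with b | b
  · rfl
  · fin_cases b; rfl

theorem realize_replacement {n : ℕ} (φ : LSet.Formula (Fin n ⊕ Fin 2)) :
    U ⊨ replacement φ ↔ ∀ (p : Fin n → U) (A : U),
      (∀ x, E x A → ∃ k, ∀ y, φ.Realize (Sum.elim p ![x, y]) ↔ y = k) →
      ∃ B, ∀ y, E y B ↔ ∃ x, E x A ∧ φ.Realize (Sum.elim p ![x, y]) := by
  unfold replacement
  rw [realize_close]
  refine forall_congr' fun p => ?_
  simp only [Formula.Realize, BoundedFormula.realize_all, BoundedFormula.realize_ex,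
    BoundedFormula.realize_iff, BoundedFormula.realize_inf, BoundedFormula.realize_imp,
    BoundedFormula.realize_bdEqual, realize_memF, realize_app, realize_bvar]
  refine forall_congr' fun A => imp_congr
    (forall_congr' fun x => imp_congr Iff.rfl (exists_congr fun k => forall_congr' fun y =>
      iff_congr (iff_of_eq (congrArg (fun w => φ.Realize w) ?_)) Iff.rfl))
    (exists_congr fun x => forall_congr' fun y => iff_congr Iff.rfl (exists_congr fun z =>
      and_congr Iff.rfl (iff_of_eq (congrArg (fun w => φ.Realize w) ?_))))
  all_goals
    funext b
    rcases b with b | b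
    · rfl
    · fin_cases b <;> rfl

theorem ZFModel.models (h : ZFModel U) (hf : Founded U) : U ⊨ ZF := by
  refine ⟨fun σ hσ => ?_⟩
  cases hσ with
  | extensionality => exact realize_extensionality.2 h.ext
  | foundation => exact realize_foundation.2 hf
  | pairing => exact realize_pairing.2 h.pairing
  | union => exact realize_union.2 h.union
  | power => exact realize_power.2 h.power
  | infinity => exact realize_infinity.2 h.infinity
  | separation φ =>
    refine (realize_separation φ).2 fun p A => h.sep _ ?_ A
    let f : _ ⊕ Fin 1 → (Fin 1 → U) → U := Sum.elim (fun i _ => p i) (fun _ xs => xs 0)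
    have : ∀ b, Tm id (f b) := by
      rintro (b | b)
      exacts [Tm.const _, Tm.var _]
    refine Dfn.congr (h := Dfn.formula (v := id) φ f) fun xs =>
      iff_of_eq (congrArg (fun w => φ.Realize w) ?_)
    funext b; rcases b with b | b <;> rfl
  | replacement φ =>
    refine (realize_replacement φ).2 fun p A hA =>
      h.repl (fun x y => φ.Realize (Sum.elim p ![x, y])) ?_ A hA
    let f : _ ⊕ Fin 2 → (Fin 2 → U) → U := Sum.elim (fun i _ => p i) (fun i xs => xs i)
    have : ∀ b, Tm id (f b) := by
      rintro (b | b)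
      exacts [Tm.const _, Tm.var _]
    refine Dfn.congr (h := Dfn.formula (v := id) φ f) fun xs =>
      iff_of_eq (congrArg (fun w => φ.Realize w) ?_)
    funext b; rcases b with b | b
    · rfl
    · fin_cases b <;> rfl

theorem StarModel.of_models (h : U ⊨ ZFStarNoExtNoFound) : StarModel U where
  pairing := realize_pairing.1 (h.realize_of_mem _ .pairing)
  union := realize_union.1 (h.realize_of_mem _ .union)
  power := realize_power.1 (h.realize_of_mem _ .power)
  infinity := realize_infinity.1 (h.realize_of_mem _ .infinity)
  replacement := by
    rintro P ⟨φ, hφ⟩ A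
    obtain ⟨B, hB⟩ := (realize_replacementStar (BoundedFormula.toFormula φ |>.relabel
      (Sum.elim Empty.elim id))).1 (h.realize_of_mem _ (.replacementStar _)) A
    refine ⟨B, fun Y => ?_⟩
    rw [hB]
    refine exists_congr fun X => and_congr_right fun _ => forall_congr' fun Z => ?_
    rw [Formula.realize_relabel, BoundedFormula.realize_toFormula]
    have := hφ ![X, Z]
    refine iff_congr Iff.rfl (Iff.trans ?_ this)
    refine iff_of_eq ?_
    congr 1
    exact Subsingleton.elim _ _

end ZFModels

/-! ### The structure of pure sets -/

section PureSets

variable (M : Type) [LSet.Structure M]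

instance pureSetoid : Setoid {x : M // Pure x} where
  r x y := Coext x.1 y.1
  iseqv := ⟨fun x => Coext.refl x.1, Coext.symm, Coext.trans⟩

/-- The pure sets up to co-extensionality. -/
def PureSets : Type := Quotient (pureSetoid M)

noncomputable instance : LSet.Structure (PureSets M) where
  funMap f := f.elim
  RelMap := fun {n} (r : MemRel n) =>
    match n, r with
    | _, MemRel.mem => fun xs => E (Quotient.out (xs 0)).1 (Quotient.out (xs 1)).1

variable {M}

/-- The pure set that is given by a class. -/
def toPure (x : {x : M // Pure x}) : PureSets M := Quotient.mk _ x

theorem toPure_eq {x y : {x : M // Pure x}} : toPure x = toPure y ↔ Coext x.1 y.1 :=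
  Quotient.eq (r := pureSetoid M)

theorem toPure_surjective : Function.Surjective (toPure (M := M)) := Quotient.exists_rep

theorem E_toPure {x y : {x : M // Pure x}} : E (toPure x) (toPure y) ↔ E x.1 y.1 := by
  have hx : Coext (Quotient.out (toPure x)).1 x.1 := toPure_eq.1 (Quotient.out_eq _)
  have hy : Coext (Quotient.out (toPure y)).1 y.1 := toPure_eq.1 (Quotient.out_eq _)
  change E (Quotient.out (toPure x)).1 (Quotient.out (toPure y)).1 ↔ _
  rw [hy, y.2.1 _ _ hx]

theorem StarModel.comprehension (hM : StarModel M) {B : M} (hB : Closed B)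
    (h : ∀ x, E x B → Pure x) : ∃ b : PureSets M, ∀ x, E (toPure x) b ↔ E x.1 B :=
  ⟨toPure ⟨B, hM.pure_of_forall_mem hB h⟩, fun _ => E_toPure⟩

theorem forall_pureSets {p : PureSets M → Prop} : (∀ x, p x) ↔ ∀ x, p (toPure x) :=
  toPure_surjective.forall

theorem exists_pureSets {p : PureSets M → Prop} : (∃ x, p x) ↔ ∃ x, p (toPure x) :=
  toPure_surjective.exists

theorem StarModel.pureInterp_yields (hM : StarModel M) : pureInterp.Yields (toPure (M := M)) where
  dom x := by
    rw [← hM.pure_iff]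
    simp [pureInterp, pure, isSet, isTC, subset, transitive, coext, Formula.Realize, Fin.snoc,
      Closed, IsTC, Incl, MemTrans, Coext, and_assoc]
  eq x y := by
    rw [toPure_eq]
    simp [pureInterp, coext, Formula.Realize, Fin.snoc, Coext]
  mem x y := by
    rw [E_toPure]
    have : Closed y.1 := y.2.1
    refine Iff.trans (b := Closed y.1 ∧ E x.1 y.1) ?_ (and_iff_right this)
    simp [pureInterp, memStar, isSet, coext, Formula.Realize, Fin.snoc, Coext, Closed]
  surj := toPure_surjective

/-- A definable predicate on the quotient pulls back along `toPure` to a definable predicate on `M`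
that respects co-extensionality, so Separation in `M` applies. -/
theorem StarModel.pure_sep (hM : StarModel M) (P : PureSets M → Prop)
    (hP : Dfn id (fun xs : Fin 1 → PureSets M => P (xs 0))) {A : M} (hA : Closed A)
    (hA' : ∀ x, E x A → Pure x) : ∃ b : PureSets M, ∀ x, E (toPure x) b ↔ E x.1 A ∧ P (toPure x) := by
  have := Dfn.congr (Q := fun xs : Fin 1 → M => ∃ h : Pure (xs 0), P (toPure ⟨xs 0, h⟩))
    (h := hM.pureInterp_yields.dfn hP) fun xs => by simp [Fin.forall_fin_one]
  obtain ⟨B, hB, hB'⟩ := hM.sep (fun x => ∃ h : Pure x, P (toPure ⟨x, h⟩)) hA (by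
    rintro x y - e ⟨hx, h⟩
    refine ⟨hx.congr e, ?_⟩
    rwa [← toPure_eq (x := ⟨x, hx⟩) (y := ⟨y, hx.congr e⟩) |>.2 e])
  obtain ⟨b, hb⟩ := hM.comprehension hB (fun x hx => hA' x ((hB' x).1 hx).1)
  refine ⟨b, fun x => ?_⟩
  rw [hb, hB']
  exact and_congr_right fun _ => ⟨fun ⟨_, h⟩ => h, fun h => ⟨x.2, h⟩⟩

theorem StarModel.zfModel (hM : StarModel M) : ZFModel (PureSets M) where
  ext := by
    simp only [forall_pureSets]
    intro x y h
    simp only [E_toPure] at h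
    refine toPure_eq.2 fun z => ⟨fun hz => ?_, fun hz => ?_⟩
    · exact (h ⟨z, x.2.mem hz⟩).1 hz
    · exact (h ⟨z, y.2.mem hz⟩).2 hz
  pairing := by
    simp only [forall_pureSets]
    intro a b
    obtain ⟨p, hp⟩ := hM.pairing a.1 b.1
    obtain ⟨x, hx, hx'⟩ := hM.closure p
    have key : ∀ y, E y x ↔ Coext y a.1 ∨ Coext y b.1 := by
      intro y
      simp only [hx', hp, or_and_right, exists_or, exists_eq_left]
      exact or_congr ⟨Coext.symm, Coext.symm⟩ ⟨Coext.symm, Coext.symm⟩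
    obtain ⟨c, hc⟩ := hM.comprehension hx (fun y hy => by
      rcases (key y).1 hy with h | h
      exacts [a.2.congr h.symm, b.2.congr h.symm])
    exact ⟨c, fun y => by rw [hc, key, toPure_eq, toPure_eq]⟩
  union := by
    simp only [forall_pureSets]
    intro a
    obtain ⟨u, hu⟩ := hM.union a.1
    obtain ⟨c, hc⟩ := hM.comprehension (B := u) (fun m n e => by
      rw [hu, hu]
      exact exists_congr fun z => and_congr_right fun hz => (a.2.mem hz).1 m n e) (fun x hx => by
      obtain ⟨z, hz, hx⟩ := (hu x).1 hx
      exact (a.2.mem hz).mem hx)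
    refine ⟨c, fun y => ?_⟩
    simp only [hc, hu, exists_pureSets, E_toPure]
    exact ⟨fun ⟨z, hz, h⟩ => ⟨⟨z, a.2.mem hz⟩, hz, h⟩, fun ⟨z, hz, h⟩ => ⟨z, hz, h⟩⟩
  power := by
    simp only [forall_pureSets]
    intro a
    obtain ⟨p, hp⟩ := hM.power a.1
    obtain ⟨q, hq, hq'⟩ := hM.sep Closed (A := p) (fun m n e => by
      rw [hp, hp]; exact forall_congr' fun z => by rw [e]) (fun x y _ e h => h.congr e)
    obtain ⟨c, hc⟩ := hM.comprehension hq (fun x hx => by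
      obtain ⟨h1, h2⟩ := (hq' x).1 hx
      exact hM.pure_of_forall_mem h2 fun y hy => a.2.mem ((hp x).1 h1 y hy))
    refine ⟨c, fun y => ?_⟩
    rw [hc, hq', hp, and_iff_left y.2.1]
    simp only [E_toPure]
    exact ⟨fun h z hz => h z.1 hz, fun h z hz => h ⟨z, y.2.mem hz⟩ hz⟩
  infinity := by
    obtain ⟨I, hI, hI', h0, hS⟩ := hM.pure_infinity
    obtain ⟨c, hc⟩ := hM.comprehension hI hI'
    simp only [exists_pureSets, forall_pureSets]
    obtain ⟨c, rfl⟩ := toPure_surjective c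
    refine ⟨c, ?_, fun x hx => ?_⟩
    · obtain ⟨e, he⟩ := hM.exists_empty
      refine ⟨⟨e, hI' e (h0 e he)⟩, (hc _).2 (h0 e he), fun z hz => he z.1 (E_toPure.1 hz)⟩
    · obtain ⟨y, hy, hy'⟩ := hM.insert x.2.1 x.1
      have hyI := hS x.1 y ((hc x).1 hx) hy hy'
      refine ⟨⟨y, hI' y hyI⟩, (hc _).2 hyI, fun z => ?_⟩
      rw [E_toPure, E_toPure, toPure_eq, hy']
      exact or_congr_right ⟨Coext.symm, Coext.symm⟩
  sep P hP := by
    simp only [forall_pureSets]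
    intro A
    obtain ⟨b, hb⟩ := hM.pure_sep P hP A.2.1 fun x hx => A.2.mem hx
    exact ⟨b, fun y => by rw [hb, E_toPure]⟩
  repl R hR := by
    rw [forall_pureSets]
    intro A hA
    have := Dfn.congr
      (Q := fun xs : Fin 2 → M => ∃ (h : Pure (xs 0)) (h' : Pure (xs 1)),
        R (toPure ⟨xs 0, h⟩) (toPure ⟨xs 1, h'⟩))
      (h := hM.pureInterp_yields.dfn hR) fun xs => by
        constructor
        · rintro ⟨h, hr⟩; exact ⟨h 0, h 1, hr⟩
        · rintro ⟨h, h', hr⟩; exact ⟨fun i => by fin_cases i <;> assumption, hr⟩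
    have := fun {n} (s t : (Fin n → M) → M) [Tm id s] [Tm id t] => Dfn.comp₂
      (P := fun x y => ∃ (h : Pure x) (h' : Pure y), R (toPure ⟨x, h⟩) (toPure ⟨y, h'⟩)) this s t
    -- The value at `X` is described by its elements. The classes `k` related to `X` are all
    -- co-extensional, so it does not matter which of them supplies `Z`.
    obtain ⟨B, hB⟩ := hM.param_replacement (fun X Z => ∃ k,
      (∃ (h : Pure X) (h' : Pure k), R (toPure ⟨X, h⟩) (toPure ⟨k, h'⟩)) ∧ E Z k) A.1
    have key : ∀ y, E y B ↔ ∃ x k, E x A.1 ∧ (∃ (h : Pure x) (h' : Pure k),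
        R (toPure ⟨x, h⟩) (toPure ⟨k, h'⟩)) ∧ Coext y k := by
      intro y
      rw [hB]
      refine exists_congr fun x => ?_
      rw [exists_and_left]
      refine and_congr_right fun hx => ?_
      have hxp := A.2.mem hx
      obtain ⟨k, hk⟩ := hA (toPure ⟨x, hxp⟩) (E_toPure.2 hx)
      obtain ⟨k, rfl⟩ := toPure_surjective k
      have hk' : ∀ l, (∃ (h : Pure x) (h' : Pure l), R (toPure ⟨x, h⟩) (toPure ⟨l, h'⟩)) ↔
          Coext l k.1 := by
        intro l
        constructor
        · rintro ⟨_, h', hr⟩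
          exact toPure_eq.1 ((hk _).1 hr)
        · intro e
          exact ⟨hxp, k.2.congr e.symm, (hk _).2 (toPure_eq.2 e)⟩
      simp only [hk']
      have h1 : ∀ Z, (∃ l, Coext l k.1 ∧ E Z l) ↔ E Z k.1 := fun Z =>
        ⟨fun ⟨l, e, h⟩ => (e Z).1 h, fun h => ⟨k.1, Coext.refl _, h⟩⟩
      simp only [h1]
      exact ⟨fun h => ⟨k.1, Coext.refl _, h⟩, fun ⟨l, h, h'⟩ => h'.trans h⟩
    obtain ⟨b, hb⟩ := hM.comprehension (B := B) (fun m n e => by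
      rw [hB, hB]; exact exists_congr fun x => and_congr_right fun _ =>
        forall_congr' fun z => by rw [e]) (fun x hx => by
      obtain ⟨_, k, -, ⟨-, hk, -⟩, e⟩ := (key x).1 hx
      exact hk.congr e.symm)
    refine ⟨b, ?_⟩
    simp only [forall_pureSets, exists_pureSets, hb, key, E_toPure]
    intro y
    constructor
    · rintro ⟨x, k, hx, ⟨h, h', hr⟩, e⟩
      refine ⟨⟨x, h⟩, hx, ?_⟩
      rwa [show toPure y = toPure ⟨k, h'⟩ from toPure_eq.2 e]
    · rintro ⟨x, hx, hr⟩
      exact ⟨x.1, y.1, hx, ⟨x.2, y.2, hr⟩, Coext.refl _⟩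

theorem founded_pureSets (h : Founded M) : Founded (PureSets M) := by
  unfold Founded
  simp only [forall_pureSets, exists_pureSets, E_toPure]
  rintro A ⟨x, hx⟩
  obtain ⟨y, hy, hmin⟩ := h A.1 ⟨x.1, hx⟩
  exact ⟨⟨y, A.2.mem hy⟩, hy, fun ⟨z, hz⟩ => hmin ⟨z.1, hz⟩⟩

theorem StarModel.nonempty_pureSets (hM : StarModel M) : Nonempty (PureSets M) :=
  have ⟨_, he⟩ := hM.exists_empty
  ⟨toPure ⟨_, (hM.wfPure_empty he).pure⟩⟩

end PureSets

theorem pureInterp_interprets : pureInterp.Interprets ZFStarNoExt ZF := by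
  intro σ hσ M v xs
  have hM : StarModel M := .of_models (Theory.Model.mono M.is_model (Set.subset_insert _ _))
  have hf : Founded M := realize_foundation.1 (M.is_model.realize_of_mem _ (Set.mem_insert _ _))
  have := hM.zfModel.models (founded_pureSets hf)
  have := hM.nonempty_pureSets
  rw [Subsingleton.elim v default, Subsingleton.elim xs default,
    hM.pureInterp_yields.realize_sentence]
  exact hσ (Theory.ModelType.of ZF (PureSets M)) default default

/-! ### Hierarchy-building functions and the meaning of their defining formulas. -/

section Hierarchy

variable {U : Type} [LSet.Structure U] {α : Type} {v : α → U} {n : ℕ}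

/-- `c = a ∪ {a}` -/
def SuccOf (a c : U) : Prop := ∀ y, E y c ↔ E y a ∨ y = a

instance Dfn.succOf (s t : (Fin n → U) → U) [Tm v s] [Tm v t] :
    Dfn v (fun xs => SuccOf (s xs) (t xs)) := by
  unfold SuccOf; infer_instance

/-- `b` is the power set of `a`. -/
def PowOf (a b : U) : Prop := ∀ y, E y b ↔ Incl y a

instance Dfn.powOf (s t : (Fin n → U) → U) [Tm v s] [Tm v t] :
    Dfn v (fun xs => PowOf (s xs) (t xs)) := by
  unfold PowOf; infer_instance

def IsEmp (x : U) : Prop := ∀ z, ¬ E z x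

instance Dfn.isEmp (s : (Fin n → U) → U) [Tm v s] : Dfn v (fun xs => IsEmp (s xs)) := by
  unfold IsEmp; infer_instance

def Lim (x : U) : Prop := ¬ IsEmp x ∧ ¬ ∃ a, SuccOf a x

instance Dfn.lim (s : (Fin n → U) → U) [Tm v s] : Dfn v (fun xs => Lim (s xs)) := by
  unfold Lim; infer_instance

/-- Von Neumann ordinals. -/
def Ord (d : U) : Prop := MemTrans d ∧ (∀ x, E x d → MemTrans x) ∧
  ∀ s, Incl s d → (∃ y, E y s) → ∃ y, E y s ∧ ¬ ∃ z, E z s ∧ E z y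

instance Dfn.ord (s : (Fin n → U) → U) [Tm v s] : Dfn v (fun xs => Ord (s xs)) := by
  unfold Ord; infer_instance

def FunOn (F d : U) : Prop := (∀ p, E p F → ∃ a b, E a d ∧ OP p a b) ∧
  (∀ a, E a d → ∃ b, Maps F a b) ∧ ∀ a b c, Maps F a b → Maps F a c → b = c

instance Dfn.funOn (s t : (Fin n → U) → U) [Tm v s] [Tm v t] :
    Dfn v (fun xs => FunOn (s xs) (t xs)) := by
  unfold FunOn; infer_instance

/-- `F` is a hierarchy-building function with domain `d`. -/
structure HierOn (F d : U) : Prop where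
  ord : Ord d
  funOn : FunOn F d
  zero : ∀ a b, IsEmp a → Maps F a b → IsEmp b
  succ : ∀ a c x y, SuccOf a c → Maps F a x → Maps F c y → PowOf x y
  lim : ∀ a b, Lim a → Maps F a b → ∀ z, E z b ↔ ∃ g y, E g a ∧ Maps F g y ∧ E z y

theorem hierOn_iff {F d : U} : HierOn F d ↔ (Ord d ∧ FunOn F d) ∧
    (∀ a b, IsEmp a → Maps F a b → IsEmp b) ∧
    (∀ a c x y, SuccOf a c → Maps F a x → Maps F c y → PowOf x y) ∧
    ∀ a b, Lim a → Maps F a b → ∀ z, E z b ↔ ∃ g y, E g a ∧ Maps F g y ∧ E z y :=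
  ⟨fun h => ⟨⟨h.ord, h.funOn⟩, h.zero, h.succ, h.lim⟩,
    fun ⟨⟨h1, h2⟩, h3, h4, h5⟩ => ⟨h1, h2, h3, h4, h5⟩⟩

instance Dfn.hierOn (s t : (Fin n → U) → U) [Tm v s] [Tm v t] :
    Dfn v (fun xs => HierOn (s xs) (t xs)) := by
  simp only [hierOn_iff]; infer_instance

/-- `b` is the stage `a` of the cumulative hierarchy. -/
def Stage (a b : U) : Prop := ∃ F d, HierOn F d ∧ Maps F a b

instance Dfn.stage (s t : (Fin n → U) → U) [Tm v s] [Tm v t] :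
    Dfn v (fun xs => Stage (s xs) (t xs)) := by
  unfold Stage; infer_instance

/-- `x` lies in a cumulative hierarchy. -/
def InStage (x : U) : Prop := ∃ a b, Stage a b ∧ E x b

instance Dfn.inStage (s : (Fin n → U) → U) [Tm v s] : Dfn v (fun xs => InStage (s xs)) := by
  unfold InStage; infer_instance

theorem realize_inHierarchy (x : U) : inHierarchy.Realize (fun _ => x) ↔ InStage x := by
  have hE : ∀ (w : Fin 1 → U) (xs : Fin 0 → U),
      BoundedFormula.Realize isEmpty w xs ↔ IsEmp (w 0) := by
    intro w xs; simp [isEmpty, IsEmp, Fin.snoc]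
  have hSub : ∀ (w : Fin 2 → U) (xs : Fin 0 → U),
      BoundedFormula.Realize subset w xs ↔ Incl (w 0) (w 1) := by
    intro w xs; simp [subset, Incl, Fin.snoc]
  have hTr : ∀ (w : Fin 1 → U) (xs : Fin 0 → U),
      BoundedFormula.Realize transitive w xs ↔ MemTrans (w 0) := by
    intro w xs; simp [transitive, MemTrans, Formula.Realize, Fin.snoc, hSub]
  have hPr : ∀ (w : Fin 3 → U) (xs : Fin 0 → U),
      BoundedFormula.Realize isPair w xs ↔ Pr (w 0) (w 1) (w 2) := by
    intro w xs; simp [isPair, Pr, Fin.snoc]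
  have hOP : ∀ (w : Fin 3 → U) (xs : Fin 0 → U),
      BoundedFormula.Realize isOrderedPair w xs ↔ OP (w 0) (w 1) (w 2) := by
    intro w xs; simp [isOrderedPair, OP, Formula.Realize, Fin.snoc, hPr, and_assoc]
  have hS : ∀ (w : Fin 2 → U) (xs : Fin 0 → U),
      BoundedFormula.Realize isSucc w xs ↔ SuccOf (w 0) (w 1) := by
    intro w xs; simp [isSucc, SuccOf, Fin.snoc]
  have hP : ∀ (w : Fin 2 → U) (xs : Fin 0 → U),
      BoundedFormula.Realize isPower w xs ↔ PowOf (w 0) (w 1) := by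
    intro w xs; simp [isPower, PowOf, Formula.Realize, Fin.snoc, hSub]
  have hO : ∀ (w : Fin 1 → U) (xs : Fin 0 → U),
      BoundedFormula.Realize isOrdinal w xs ↔ Ord (w 0) := by
    intro w xs
    simp [isOrdinal, Ord, Formula.Realize, Fin.snoc, hSub, hTr, and_assoc]
  have hL : ∀ (w : Fin 1 → U) (xs : Fin 0 → U),
      BoundedFormula.Realize isLimit w xs ↔ Lim (w 0) := by
    intro w xs; simp [isLimit, Lim, Formula.Realize, Fin.snoc, hE, hS]
  have hM : ∀ (w : Fin 3 → U) (xs : Fin 0 → U),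
      BoundedFormula.Realize maps w xs ↔ Maps (w 0) (w 1) (w 2) := by
    intro w xs; simp [maps, Maps, Formula.Realize, Fin.snoc, hOP]
  have hF : ∀ (w : Fin 2 → U) (xs : Fin 0 → U),
      BoundedFormula.Realize isFunOn w xs ↔ FunOn (w 0) (w 1) := by
    intro w xs
    simp [isFunOn, FunOn, Formula.Realize, Fin.snoc, hOP, hM, and_assoc]
  have hH : ∀ (w : Fin 1 → U) (xs : Fin 0 → U),
      BoundedFormula.Realize isHierarchy w xs ↔ ∃ d, HierOn (w 0) d := by
    intro w xs
    simp only [hierOn_iff, exists_and_right]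
    simp [isHierarchy, Formula.Realize, Fin.snoc, hO, hF, hE, hS, hM, hP, hL, and_assoc]
  simp [inHierarchy, InStage, Stage, Formula.Realize, Fin.snoc, hH, hM]
  constructor
  · rintro ⟨F, a, b, ⟨hF, hab⟩, hx⟩
    exact ⟨a, b, ⟨F, hF, hab⟩, hx⟩
  · rintro ⟨a, b, ⟨F, hF, hab⟩, hx⟩
    exact ⟨F, a, b, ⟨hF, hab⟩, hx⟩

end Hierarchy

/-! ### Ordinals in ZF without Foundation. -/

section Ordinals

variable {U : Type} [LSet.Structure U]

theorem ZFModel.separate (h : ZFModel U) (P : U → Prop)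
    [hP : Dfn id (fun xs : Fin 1 → U => P (xs 0))] (A : U) : ∃ x, ∀ y, E y x ↔ E y A ∧ P y :=
  h.sep P hP A

theorem ZFModel.replace (h : ZFModel U) (R : U → U → Prop)
    [hR : Dfn id (fun xs : Fin 2 → U => R (xs 0) (xs 1))] (A : U)
    (hA : ∀ x, E x A → ∃ k, ∀ y, R x y ↔ y = k) : ∃ B, ∀ y, E y B ↔ ∃ x, E x A ∧ R x y :=
  h.repl R hR A hA

theorem ZFModel.exists_empty (h : ZFModel U) : ∃ e : U, IsEmp e := by
  obtain ⟨N, ⟨e, -, he⟩, -⟩ := h.infinity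
  exact ⟨e, he⟩

theorem ZFModel.adjoin (h : ZFModel U) (a b : U) : ∃ x, ∀ y, E y x ↔ E y a ∨ y = b := by
  obtain ⟨s, hs⟩ := h.pairing b b
  obtain ⟨p, hp⟩ := h.pairing a s
  obtain ⟨x, hx⟩ := h.union p
  refine ⟨x, fun y => ?_⟩
  simp only [hx, hp, or_and_right, exists_or, exists_eq_left, hs, or_self]

theorem ZFModel.exists_op (h : ZFModel U) (a b : U) : ∃ p, OP p a b := by
  obtain ⟨s, hs⟩ := h.pairing a a
  obtain ⟨c, hc⟩ := h.pairing a b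
  obtain ⟨p, hp⟩ := h.pairing s c
  exact ⟨p, s, c, hs, hc, hp⟩

theorem ZFModel.pr_unique (h : ZFModel U) {x y a b : U} (hx : Pr x a b) (hy : Pr y a b) : x = y :=
  h.ext x y fun z => (hx z).trans (hy z).symm

theorem ZFModel.op_unique (h : ZFModel U) {p q a b : U} (hp : OP p a b) (hq : OP q a b) :
    p = q := by
  obtain ⟨s, c, h1, h2, h3⟩ := hp
  obtain ⟨s', c', h1', h2', h3'⟩ := hq
  obtain rfl := h.pr_unique h1 h1'
  obtain rfl := h.pr_unique h2 h2'
  exact h.pr_unique h3 h3'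

theorem Ord.mem {d a : U} (hd : Ord d) (ha : E a d) : Ord a := by
  refine ⟨hd.2.1 a ha, fun x hx => hd.2.1 x (hd.1 a ha x hx), fun s hs => ?_⟩
  exact hd.2.2 s fun z hz => hd.1 a ha z (hs z hz)

/-- Induction on ordinals. -/
theorem ZFModel.ord_induction (h : ZFModel U) (P : U → Prop)
    [hP : Dfn id (fun xs : Fin 1 → U => P (xs 0))]
    (step : ∀ a, Ord a → (∀ b, E b a → P b) → P a) : ∀ a, Ord a → P a := by
  intro a ha
  have := fun {n} (t : (Fin n → U) → U) [Tm id t] => Dfn.comp₁ hP t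
  obtain ⟨s, hs⟩ := h.separate (fun b => ¬ P b) a
  refine step a ha fun b hb => ?_
  by_contra hPb
  obtain ⟨m, hm, hmin⟩ := ha.2.2 s (fun z hz => ((hs z).1 hz).1) ⟨b, (hs b).2 ⟨hb, hPb⟩⟩
  obtain ⟨hma, hPm⟩ := (hs m).1 hm
  refine hPm (step m (ha.mem hma) fun c hc => ?_)
  by_contra hPc
  exact hmin ⟨c, (hs c).2 ⟨ha.1 m hma c hc, hPc⟩, hc⟩

theorem ZFModel.ord_least (h : ZFModel U) (P : U → Prop)
    [hP : Dfn id (fun xs : Fin 1 → U => P (xs 0))] {a : U} (ha : Ord a) (hPa : P a) :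
    ∃ b, Ord b ∧ P b ∧ ∀ c, E c b → ¬ P c := by
  by_contra hne
  have := fun {n} (t : (Fin n → U) → U) [Tm id t] => Dfn.comp₁ hP t
  exact h.ord_induction (fun b => ¬ P b) (fun b hb ih hPb => hne ⟨b, hb, hPb, ih⟩) a ha hPa

theorem ZFModel.ord_irrefl (h : ZFModel U) {a : U} (ha : Ord a) : ¬ E a a :=
  h.ord_induction (fun a => ¬ E a a) (fun a _ ih h => ih a h h) a ha

theorem ZFModel.ord_succ_inj (h : ZFModel U) {a b c : U} (ha : Ord a) (hac : SuccOf a c)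
    (hbc : SuccOf b c) : a = b := by
  rcases (hbc a).1 ((hac a).2 (.inr rfl)) with hab | hab
  · rcases (hac b).1 ((hbc b).2 (.inr rfl)) with hba | hba
    · exact (h.ord_irrefl ha (ha.1 b hba a hab)).elim
    · exact hba.symm
  · exact hab

/-- Double induction: if neither ordinal is an element of the other, the two induction hypotheses
show that they have the same elements. -/
theorem ZFModel.ord_trichotomy (h : ZFModel U) {a b : U} (ha : Ord a) (hb : Ord b) :
    E a b ∨ a = b ∨ E b a := by
  refine h.ord_induction (fun a => ∀ b, Ord b → E a b ∨ a = b ∨ E b a) ?_ a ha b hb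
  intro a ha iha b hb
  refine h.ord_induction (fun b => E a b ∨ a = b ∨ E b a) ?_ b hb
  intro b hb ihb
  by_cases hab : E a b
  · exact .inl hab
  by_cases hba : E b a
  · exact .inr (.inr hba)
  refine .inr (.inl (h.ext a b fun z => ⟨fun hz => ?_, fun hz => ?_⟩))
  · rcases iha z hz b hb with h' | rfl | h'
    · exact h'
    · exact (hba hz).elim
    · exact (hba (ha.1 z hz b h')).elim
  · rcases ihb z hz with h' | rfl | h'
    · exact (hab (hb.1 z hz a h')).elim
    · exact (hab hz).elim
    · exact h'

theorem ZFModel.ord_succ (h : ZFModel U) {d d' : U} (hd : Ord d) (hd' : SuccOf d d') : Ord d' := by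
  refine ⟨fun z hz w hw => ?_, fun z hz => ?_, fun s hs ⟨y, hy⟩ => ?_⟩
  · refine (hd' w).2 (.inl ?_)
    rcases (hd' z).1 hz with h' | rfl
    exacts [hd.1 z h' w hw, hw]
  · rcases (hd' z).1 hz with h' | rfl
    exacts [hd.2.1 z h', hd.1]
  · obtain ⟨t, ht⟩ := h.separate (fun y => E y d) s
    by_cases hne : ∃ y, E y t
    · obtain ⟨y, hy, hmin⟩ := hd.2.2 t (fun z hz => ((ht z).1 hz).2) hne
      obtain ⟨hys, hyd⟩ := (ht y).1 hy
      exact ⟨y, hys, fun ⟨z, hz, hzy⟩ => hmin ⟨z, (ht z).2 ⟨hz, hd.1 y hyd z hzy⟩, hzy⟩⟩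
    · have hsd : ∀ z, E z s → z = d := fun z hz =>
        ((hd' z).1 (hs z hz)).resolve_left fun h' => hne ⟨z, (ht z).2 ⟨hz, h'⟩⟩
      obtain rfl := hsd y hy
      refine ⟨y, hy, fun ⟨z, hz, hzy⟩ => ?_⟩
      obtain rfl := hsd z hz
      exact h.ord_irrefl hd hzy

/-- The union of the successors of a set of ordinals. -/
theorem ZFModel.ord_sup (h : ZFModel U) (A : U) (hA : ∀ a, E a A → Ord a) :
    ∃ d, Ord d ∧ ∀ g, E g d ↔ ∃ a, E a A ∧ (E g a ∨ g = a) := by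
  have hR : ∀ a, E a A → ∃ k, ∀ y, SuccOf a y ↔ y = k := by
    intro a _
    obtain ⟨k, hk⟩ := h.adjoin a a
    exact ⟨k, fun y => ⟨fun hy => h.ext y k fun z => (hy z).trans (hk z).symm,
      fun e => e ▸ hk⟩⟩
  obtain ⟨B, hB⟩ := h.replace SuccOf A hR
  obtain ⟨d, hd⟩ := h.union B
  have hBo : ∀ b, E b B → Ord b := by
    intro b hb
    obtain ⟨a, ha, hab⟩ := (hB b).1 hb
    exact h.ord_succ (hA a ha) hab
  refine ⟨d, ⟨fun z hz w hw => ?_, fun z hz => ?_, fun s hs ⟨y, hy⟩ => ?_⟩, fun g => ?_⟩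
  · obtain ⟨b, hb, hzb⟩ := (hd z).1 hz
    exact (hd w).2 ⟨b, hb, (hBo b hb).1 z hzb w hw⟩
  · obtain ⟨b, hb, hzb⟩ := (hd z).1 hz
    exact (hBo b hb).2.1 z hzb
  · obtain ⟨b, hb, hyb⟩ := (hd y).1 (hs y hy)
    obtain ⟨t, ht⟩ := h.separate (fun y => E y b) s
    obtain ⟨m, hm, hmin⟩ := (hBo b hb).2.2 t (fun z hz => ((ht z).1 hz).2) ⟨y, (ht y).2 ⟨hy, hyb⟩⟩
    obtain ⟨hms, hmb⟩ := (ht m).1 hm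
    exact ⟨m, hms, fun ⟨z, hz, hzm⟩ => hmin ⟨z, (ht z).2 ⟨hz, (hBo b hb).1 m hmb z hzm⟩, hzm⟩⟩
  · rw [hd]
    constructor
    · rintro ⟨b, hb, hgb⟩
      obtain ⟨a, ha, hab⟩ := (hB b).1 hb
      exact ⟨a, ha, (hab g).1 hgb⟩
    · rintro ⟨a, ha, hg⟩
      obtain ⟨k, hk⟩ := h.adjoin a a
      exact ⟨k, (hB k).2 ⟨a, ha, hk⟩, (hk g).2 hg⟩

end Ordinals

/-! ### Stages of the cumulative hierarchy. -/

section Stages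

variable {U : Type} [LSet.Structure U]

theorem empty_or_succ_or_lim (a : U) : IsEmp a ∨ (∃ c, SuccOf c a) ∨ Lim a := by
  unfold Lim; tauto

theorem FunOn.mem_of_maps {F d a b : U} (hF : FunOn F d) (h : Maps F a b) : E a d := by
  obtain ⟨p, hp, hab⟩ := h
  obtain ⟨a', b', ha', h'⟩ := hF.1 p hp
  exact (hab.inj h').1 ▸ ha'

theorem HierOn.mem {F d a b : U} (hF : HierOn F d) (h : Maps F a b) : E a d :=
  hF.funOn.mem_of_maps h

/-- Two hierarchy-building functions agree where both are defined. -/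
theorem ZFModel.hierOn_agree (h : ZFModel U) {F F' d d' : U} (hF : HierOn F d)
    (hF' : HierOn F' d') {a b b' : U} (hab : Maps F a b) (hab' : Maps F' a b') : b = b' := by
  refine h.ord_induction (fun a => ∀ b b', Maps F a b → Maps F' a b' → b = b') ?_ a
    (hF.ord.mem (hF.mem hab)) b b' hab hab'
  intro a ha ih b b' hb hb'
  have had := hF.mem hb
  have had' := hF'.mem hb'
  have h1 : ∀ g, E g a → ∃ y, Maps F g y ∧ Maps F' g y := by
    intro g hg
    obtain ⟨y, hy⟩ := hF.funOn.2.1 g (hF.ord.1 a had g hg)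
    obtain ⟨y', hy'⟩ := hF'.funOn.2.1 g (hF'.ord.1 a had' g hg)
    obtain rfl := ih g hg y y' hy hy'
    exact ⟨y, hy, hy'⟩
  refine h.ext b b' fun z => ?_
  rcases empty_or_succ_or_lim a with ha0 | ⟨c, hc⟩ | hl
  · exact iff_of_false (hF.zero a b ha0 hb z) (hF'.zero a b' ha0 hb' z)
  · obtain ⟨y, hy, hy'⟩ := h1 c ((hc c).2 (.inr rfl))
    rw [hF.succ c a y b hc hy hb, hF'.succ c a y b' hc hy' hb']
  · rw [hF.lim a b hl hb, hF'.lim a b' hl hb']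
    refine exists_congr fun g => ⟨?_, ?_⟩
    · rintro ⟨y, hg, hy, hz⟩
      obtain ⟨y', h2, h3⟩ := h1 g hg
      obtain rfl := hF.funOn.2.2 g y y' hy h2
      exact ⟨y, hg, h3, hz⟩
    · rintro ⟨y, hg, hy, hz⟩
      obtain ⟨y', h2, h3⟩ := h1 g hg
      obtain rfl := hF'.funOn.2.2 g y y' hy h3
      exact ⟨y, hg, h2, hz⟩

theorem Stage.ord {a b : U} (h : Stage a b) : Ord a := by
  obtain ⟨F, d, hF, h⟩ := h
  exact hF.ord.mem (hF.mem h)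

theorem ZFModel.stage_unique (h : ZFModel U) {a b b' : U} (hb : Stage a b) (hb' : Stage a b') :
    b = b' := by
  obtain ⟨F, d, hF, hb⟩ := hb
  obtain ⟨F', d', hF', hb'⟩ := hb'
  exact h.hierOn_agree hF hF' hb hb'

theorem Stage.exists_of_mem {a b g : U} (h : Stage a b) (hg : E g a) : ∃ y, Stage g y := by
  obtain ⟨F, d, hF, h⟩ := h
  obtain ⟨y, hy⟩ := hF.funOn.2.1 g (hF.ord.1 a (hF.mem h) g hg)
  exact ⟨y, F, d, hF, hy⟩

theorem Stage.zero {a b : U} (h : Stage a b) (ha : IsEmp a) : IsEmp b := by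
  obtain ⟨F, d, hF, h⟩ := h
  exact hF.zero a b ha h

theorem ZFModel.stage_succ (h : ZFModel U) {a c x y : U} (hac : SuccOf a c) (hx : Stage a x)
    (hy : Stage c y) : PowOf x y := by
  obtain ⟨F, d, hF, hy⟩ := hy
  obtain ⟨x', hx'⟩ := hF.funOn.2.1 a (hF.ord.1 c (hF.mem hy) a ((hac a).2 (.inr rfl)))
  obtain rfl := h.stage_unique hx ⟨F, d, hF, hx'⟩
  exact hF.succ a c x y hac hx' hy

theorem ZFModel.stage_lim (h : ZFModel U) {a b : U} (ha : Lim a) (hb : Stage a b) (z : U) :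
    E z b ↔ ∃ g y, E g a ∧ Stage g y ∧ E z y := by
  obtain ⟨F, d, hF, hb⟩ := hb
  rw [hF.lim a b ha hb]
  refine exists_congr fun g => ⟨?_, ?_⟩
  · rintro ⟨y, hg, hy, hz⟩
    exact ⟨y, hg, ⟨F, d, hF, hy⟩, hz⟩
  · rintro ⟨y, hg, hy, hz⟩
    obtain ⟨y', hy'⟩ := hF.funOn.2.1 g (hF.ord.1 a (hF.mem hb) g hg)
    obtain rfl := h.stage_unique hy ⟨F, d, hF, hy'⟩
    exact ⟨y, hg, hy', hz⟩

/-- Stages are transitive and increasing. -/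
theorem ZFModel.stage_trans_mono (h : ZFModel U) {a b : U} (hb : Stage a b) :
    MemTrans b ∧ ∀ g y, E g a → Stage g y → Incl y b := by
  refine h.ord_induction
    (fun a => ∀ b, Stage a b → MemTrans b ∧ ∀ g y, E g a → Stage g y → Incl y b) ?_ a hb.ord b hb
  intro a _ ih b hb
  rcases empty_or_succ_or_lim a with ha0 | ⟨c, hc⟩ | hl
  · exact ⟨fun z hz => (hb.zero ha0 z hz).elim, fun g _ hg => (ha0 g hg).elim⟩
  · have hca := (hc c).2 (.inr rfl)
    obtain ⟨x, hx⟩ := hb.exists_of_mem hca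
    have hp := h.stage_succ hc hx hb
    obtain ⟨hxt, hxm⟩ := ih c hca x hx
    have hxb : Incl x b := fun w hw => (hp w).2 (hxt w hw)
    refine ⟨fun z hz w hw => hxb w ((hp z).1 hz w hw), fun g y hg hy => ?_⟩
    rcases (hc g).1 hg with h' | rfl
    · exact fun z hz => hxb z (hxm g y h' hy z hz)
    · obtain rfl := h.stage_unique hx hy
      exact hxb
  · refine ⟨fun z hz w hw => ?_, fun g y hg hy z hz => (h.stage_lim hl hb z).2 ⟨g, y, hg, hy, hz⟩⟩
    obtain ⟨g, y, hg, hy, hz⟩ := (h.stage_lim hl hb z).1 hz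
    exact (h.stage_lim hl hb w).2 ⟨g, y, hg, hy, (ih g hg y hy).1 z hz w hw⟩

/-- If all stages below an ordinal exist, they form a hierarchy-building function. -/
theorem ZFModel.exists_hierOn (h : ZFModel U) {d : U} (hd : Ord d)
    (hs : ∀ a, E a d → ∃ b, Stage a b) :
    ∃ F, HierOn F d ∧ ∀ a b, Maps F a b ↔ E a d ∧ Stage a b := by
  obtain ⟨F, hF⟩ := h.replace (fun a p => ∃ b, Stage a b ∧ OP p a b) d (by
    intro a ha
    obtain ⟨b, hb⟩ := hs a ha
    obtain ⟨p, hp⟩ := h.exists_op a b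
    refine ⟨p, fun q => ⟨?_, fun e => ⟨b, hb, e ▸ hp⟩⟩⟩
    rintro ⟨b', hb', hq⟩
    obtain rfl := h.stage_unique hb hb'
    exact h.op_unique hq hp)
  have hM : ∀ a b, Maps F a b ↔ E a d ∧ Stage a b := by
    intro a b
    constructor
    · rintro ⟨p, hp, hab⟩
      obtain ⟨a', ha', b', hb', h'⟩ := (hF p).1 hp
      obtain ⟨rfl, rfl⟩ := hab.inj h'
      exact ⟨ha', hb'⟩
    · rintro ⟨ha, hab⟩
      obtain ⟨p, hp⟩ := h.exists_op a b
      exact ⟨p, (hF p).2 ⟨a, ha, b, hab, hp⟩, hp⟩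
  refine ⟨F, ⟨hd, ⟨fun p hp => ?_, fun a ha => ?_, ?_⟩, ?_, ?_, ?_⟩, hM⟩
  · obtain ⟨a, ha, b, -, hab⟩ := (hF p).1 hp
    exact ⟨a, b, ha, hab⟩
  · obtain ⟨b, hb⟩ := hs a ha
    exact ⟨b, (hM a b).2 ⟨ha, hb⟩⟩
  · intro a b c hb hc
    exact h.stage_unique ((hM a b).1 hb).2 ((hM a c).1 hc).2
  · intro a b ha hb
    exact ((hM a b).1 hb).2.zero ha
  · intro a c x y hac hx hy
    exact h.stage_succ hac ((hM a x).1 hx).2 ((hM c y).1 hy).2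
  · intro a b ha hb z
    rw [h.stage_lim ha ((hM a b).1 hb).2]
    refine exists_congr fun g => exists_congr fun y => and_congr_right fun hg => ?_
    rw [hM, and_iff_right (hd.1 a ((hM a b).1 hb).1 g hg)]

/-- If all stages below an ordinal exist, the next one does. -/
theorem ZFModel.exists_stage (h : ZFModel U) {d : U} (hd : Ord d)
    (hs : ∀ a, E a d → ∃ b, Stage a b) : ∃ b, Stage d b := by
  obtain ⟨F, hF, hM⟩ := h.exists_hierOn hd hs
  -- `v` is the value due at `d`. Only the clause for the kind of ordinal that `d` is has content;
  -- the other two hold vacuously.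
  obtain ⟨v, hv0, hvS, hvL⟩ : ∃ v, (IsEmp d → IsEmp v) ∧
      (∀ c x, SuccOf c d → Stage c x → PowOf x v) ∧
      (Lim d → ∀ z, E z v ↔ ∃ g y, E g d ∧ Stage g y ∧ E z y) := by
    rcases empty_or_succ_or_lim d with hd0 | ⟨c, hc⟩ | hl
    · refine ⟨d, fun _ => hd0, fun c x hc => (hd0 c ((hc c).2 (.inr rfl))).elim,
        fun hl => (hl.1 hd0).elim⟩
    · have hcd := (hc c).2 (.inr rfl)
      obtain ⟨x, hx⟩ := hs c hcd
      obtain ⟨v, hv⟩ := h.power x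
      refine ⟨v, fun hd0 => (hd0 c hcd).elim, fun c' x' hc' hx' => ?_, fun hl => (hl.2 ⟨c, hc⟩).elim⟩
      obtain rfl := h.ord_succ_inj (hd.mem hcd) hc hc'
      obtain rfl := h.stage_unique hx hx'
      exact hv
    · obtain ⟨R, hR⟩ := h.replace Stage d (by
        intro a ha
        obtain ⟨b, hb⟩ := hs a ha
        exact ⟨b, fun y => ⟨fun hy => h.stage_unique hy hb, fun e => e ▸ hb⟩⟩)
      obtain ⟨v, hv⟩ := h.union R
      refine ⟨v, fun hd0 => (hl.1 hd0).elim, fun c _ hc => (hl.2 ⟨c, hc⟩).elim, fun _ z => ?_⟩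
      rw [hv]
      constructor
      · rintro ⟨y, hy, hz⟩
        obtain ⟨g, hg, hgy⟩ := (hR y).1 hy
        exact ⟨g, y, hg, hgy, hz⟩
      · rintro ⟨g, y, hg, hgy, hz⟩
        exact ⟨y, (hR y).2 ⟨g, hg, hgy⟩, hz⟩
  -- For `d` to be an argument, the domain must be its successor: `F` is extended by the single pair
  -- `(d, v)`.
  obtain ⟨d', hd'⟩ := h.adjoin d d
  obtain ⟨p, hp⟩ := h.exists_op d v
  obtain ⟨F', hF'⟩ := h.adjoin F p
  have hM' : ∀ a b, Maps F' a b ↔ (E a d ∧ Stage a b) ∨ (a = d ∧ b = v) := by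
    intro a b
    rw [← hM]
    constructor
    · rintro ⟨q, hq, hab⟩
      rcases (hF' q).1 hq with h' | rfl
      · exact .inl ⟨q, h', hab⟩
      · exact .inr (hab.inj hp)
    · rintro (⟨q, hq, hab⟩ | ⟨rfl, rfl⟩)
      · exact ⟨q, (hF' q).2 (.inl hq), hab⟩
      · exact ⟨p, (hF' p).2 (.inr rfl), hp⟩
  have hirr := h.ord_irrefl hd
  have hlow : ∀ a b, E a d → (Maps F' a b ↔ Stage a b) := by
    intro a b ha
    rw [hM', and_iff_right ha, or_iff_left]
    rintro ⟨rfl, -⟩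
    exact hirr ha
  refine ⟨v, F', d', ⟨h.ord_succ hd hd', ⟨fun q hq => ?_, fun a ha => ?_, ?_⟩, ?_, ?_, ?_⟩,
    (hM' d v).2 (.inr ⟨rfl, rfl⟩)⟩
  · rcases (hF' q).1 hq with h' | rfl
    · obtain ⟨a, b, ha, hab⟩ := hF.funOn.1 q h'
      exact ⟨a, b, (hd' a).2 (.inl ha), hab⟩
    · exact ⟨d, v, (hd' d).2 (.inr rfl), hp⟩
  · rcases (hd' a).1 ha with h' | rfl
    · obtain ⟨b, hb⟩ := hs a h'
      exact ⟨b, (hlow a b h').2 hb⟩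
    · exact ⟨v, (hM' a v).2 (.inr ⟨rfl, rfl⟩)⟩
  · intro a b c hb hc
    rcases (hM' a b).1 hb with ⟨ha, hb⟩ | ⟨rfl, rfl⟩
    · exact h.stage_unique hb ((hlow a c ha).1 hc)
    · rcases (hM' a c).1 hc with ⟨ha, -⟩ | ⟨-, rfl⟩
      exacts [(hirr ha).elim, rfl]
  · intro a b ha hb
    rcases (hM' a b).1 hb with ⟨-, hb⟩ | ⟨rfl, rfl⟩
    exacts [hb.zero ha, hv0 ha]
  · intro a c x y hac hx hy
    have hac' := (hac a).2 (.inr rfl)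
    rcases (hM' c y).1 hy with ⟨hc, hy⟩ | ⟨rfl, rfl⟩
    · exact h.stage_succ hac ((hlow a x (hd.1 c hc a hac')).1 hx) hy
    · exact hvS a x hac ((hlow a x hac').1 hx)
  · intro a b ha hb z
    have key : ∀ g, E g a → E g d := by
      rcases (hM' a b).1 hb with ⟨ha, -⟩ | ⟨rfl, -⟩
      exacts [hd.1 a ha, fun _ h => h]
    have : (∃ g y, E g a ∧ Maps F' g y ∧ E z y) ↔ ∃ g y, E g a ∧ Stage g y ∧ E z y :=
      exists_congr fun g => exists_congr fun y => and_congr_right fun hg => by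
        rw [hlow g y (key g hg)]
    rw [this]
    rcases (hM' a b).1 hb with ⟨-, hb⟩ | ⟨rfl, rfl⟩
    exacts [h.stage_lim ha hb z, hvL ha z]

theorem ZFModel.inStage_of_mem (h : ZFModel U) {x y : U} (hx : InStage x) (hy : E y x) :
    InStage y := by
  obtain ⟨a, b, hb, hxb⟩ := hx
  exact ⟨a, b, hb, (h.stage_trans_mono hb).1 x hxb y hy⟩

/-- A set whose elements lie in a cumulative hierarchy does so itself. -/
theorem ZFModel.inStage_of_forall_mem (h : ZFModel U) {x : U} (hx : ∀ y, E y x → InStage y) :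
    InStage x := by
  -- Replacement needs a unique value, so `y` is sent to the least index of a stage that contains
  -- it.
  obtain ⟨A, hA⟩ := h.replace (fun y a => (∃ b, Stage a b ∧ E y b) ∧
      ∀ c, E c a → ¬ ∃ b, Stage c b ∧ E y b) x (by
    intro y hy
    obtain ⟨a, b, hb, hyb⟩ := hx y hy
    obtain ⟨a, ha, hay, hmin⟩ := h.ord_least (fun a => ∃ b, Stage a b ∧ E y b) hb.ord ⟨b, hb, hyb⟩
    refine ⟨a, fun a' => ⟨?_, fun e => e ▸ ⟨hay, hmin⟩⟩⟩
    rintro ⟨ha'y, hmin'⟩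
    obtain ⟨b', hb', -⟩ := id ha'y
    rcases h.ord_trichotomy ha hb'.ord with h' | h' | h'
    · exact (hmin' a h' hay).elim
    · exact h'.symm
    · exact (hmin a' h' ha'y).elim)
  have hAs : ∀ a, E a A → ∃ b, Stage a b := by
    intro a ha
    obtain ⟨y, -, ⟨b, hb, -⟩, -⟩ := (hA a).1 ha
    exact ⟨b, hb⟩
  obtain ⟨d, hd, hdA⟩ := h.ord_sup A fun a ha => (hAs a ha).elim fun _ hb => hb.ord
  have hds : ∀ g, E g d → ∃ b, Stage g b := by
    intro g hg
    obtain ⟨a, ha, hga⟩ := (hdA g).1 hg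
    obtain ⟨b, hb⟩ := hAs a ha
    rcases hga with h' | rfl
    exacts [hb.exists_of_mem h', ⟨b, hb⟩]
  obtain ⟨b, hb⟩ := h.exists_stage hd hds
  -- `d` lies above all these indices, so `x` is included in stage `d` by monotonicity and is an
  -- element of the stage after it.
  obtain ⟨d', hd'⟩ := h.adjoin d d
  obtain ⟨b', hb'⟩ := h.exists_stage (h.ord_succ hd hd') fun g hg => by
    rcases (hd' g).1 hg with h' | rfl
    exacts [hds g h', ⟨b, hb⟩]
  refine ⟨d', b', hb', (h.stage_succ hd' hb hb' x).2 fun y hy => ?_⟩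
  obtain ⟨a, c, hc, hyc⟩ := hx y hy
  obtain ⟨a, -, hay, hmin⟩ := h.ord_least (fun a => ∃ b, Stage a b ∧ E y b) hc.ord ⟨c, hc, hyc⟩
  obtain ⟨c, hc, hyc⟩ := id hay
  have haA : E a A := (hA a).2 ⟨y, hy, hay, hmin⟩
  exact (h.stage_trans_mono hb).2 a c ((hdA a).2 ⟨a, haA, .inr rfl⟩) hc y hyc

/-- Choose an element of `x` in a stage of least possible index. That index must be a successor, so
the elements of the chosen set lie in an earlier stage and cannot belong to `x`. -/
theorem ZFModel.exists_minimal (h : ZFModel U) {x y : U} (hx : InStage x) (hy : E y x) :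
    ∃ y, E y x ∧ ∀ z, E z x → ¬ E z y := by
  obtain ⟨a, b, hb, hyb⟩ := h.inStage_of_mem hx hy
  obtain ⟨a, -, ⟨b, hb, y, hyb, hyx⟩, hmin⟩ := h.ord_least
    (fun a => ∃ b, Stage a b ∧ ∃ y, E y b ∧ E y x) hb.ord ⟨b, hb, y, hyb, hy⟩
  refine ⟨y, hyx, fun z hz hzy => ?_⟩
  rcases empty_or_succ_or_lim a with ha0 | ⟨c, hc⟩ | hl
  · exact hb.zero ha0 y hyb
  · have hca := (hc c).2 (.inr rfl)
    obtain ⟨w, hw⟩ := hb.exists_of_mem hca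
    exact hmin c hca ⟨w, hw, z, (h.stage_succ hc hw hb y).1 hyb z hzy, hz⟩
  · obtain ⟨g, w, hg, hw, hyw⟩ := (h.stage_lim hl hb y).1 hyb
    exact hmin g hg ⟨w, hw, y, hyw, hyx⟩

end Stages

/-! ### The model of elements of cumulative hierarchies, and the second interpretation. -/

section StageModel

variable (U : Type) [LSet.Structure U]

/-- The elements of cumulative hierarchies. -/
abbrev StageModel : Type := {x : U // InStage x}

instance : LSet.Structure (StageModel U) where
  funMap f := f.elim
  RelMap r xs := Structure.RelMap r (fun i => (xs i).1)

/-- The interpretation that restricts the universe to the elements of cumulative hierarchies. -/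
def stageInterp : Interp := ⟨inHierarchy, fv 0 =' fv 1, fv 0 ∈ₛ fv 1⟩

variable {U}

theorem E_stageModel {x y : StageModel U} : E x y ↔ E x.1 y.1 := by
  refine iff_of_eq (congrArg (Structure.RelMap (L := LSet) (M := U) MemRel.mem) ?_)
  funext i
  fin_cases i <;> rfl

theorem stageInterp_yields :
    stageInterp.Yields (fun x : {x : U // InStage x} => (x : StageModel U)) where
  dom := realize_inHierarchy
  eq x y := by simp [stageInterp, Formula.Realize, Subtype.ext_iff]
  mem x y := by rw [E_stageModel]; simp [stageInterp, Formula.Realize]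
  surj x := ⟨x, rfl⟩

theorem ZFModel.exists_stageModel (h : ZFModel U) {B : U} (hB : ∀ x, E x B → InStage x) :
    ∃ b : StageModel U, ∀ x : StageModel U, E x b ↔ E x.1 B :=
  ⟨⟨B, h.inStage_of_forall_mem hB⟩, fun _ => E_stageModel⟩

/-- The class is transitive and contains every set whose elements it contains, so each set that an
axiom yields in `U` is in it once its elements are. For Separation and Replacement,
`stageInterp_yields` turns definability in the submodel into definability in `U`. -/
theorem ZFModel.zfModel_stageModel (h : ZFModel U) : ZFModel (StageModel U) where
  ext x y hxy := by
    refine Subtype.ext (h.ext x.1 y.1 fun z => ⟨fun hz => ?_, fun hz => ?_⟩)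
    · exact E_stageModel.1 ((hxy ⟨z, h.inStage_of_mem x.2 hz⟩).1 (E_stageModel.2 hz))
    · exact E_stageModel.1 ((hxy ⟨z, h.inStage_of_mem y.2 hz⟩).2 (E_stageModel.2 hz))
  pairing a b := by
    obtain ⟨x, hx⟩ := h.pairing a.1 b.1
    obtain ⟨c, hc⟩ := h.exists_stageModel (B := x) fun y hy => by
      rcases (hx y).1 hy with rfl | rfl
      exacts [a.2, b.2]
    exact ⟨c, fun y => by rw [hc, hx]; exact or_congr Subtype.ext_iff.symm Subtype.ext_iff.symm⟩
  union a := by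
    obtain ⟨u, hu⟩ := h.union a.1
    obtain ⟨c, hc⟩ := h.exists_stageModel (B := u) fun y hy => by
      obtain ⟨z, hz, hy⟩ := (hu y).1 hy
      exact h.inStage_of_mem (h.inStage_of_mem a.2 hz) hy
    refine ⟨c, fun y => ?_⟩
    rw [hc, hu]
    constructor
    · rintro ⟨z, hz, hy⟩
      exact ⟨⟨z, h.inStage_of_mem a.2 hz⟩, E_stageModel.2 hz, E_stageModel.2 hy⟩
    · rintro ⟨z, hz, hy⟩
      exact ⟨z.1, E_stageModel.1 hz, E_stageModel.1 hy⟩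
  power a := by
    obtain ⟨p, hp⟩ := h.power a.1
    obtain ⟨c, hc⟩ := h.exists_stageModel (B := p) fun y hy =>
      h.inStage_of_forall_mem fun z hz => h.inStage_of_mem a.2 ((hp y).1 hy z hz)
    refine ⟨c, fun y => ?_⟩
    rw [hc, hp]
    constructor
    · exact fun hy z hz => E_stageModel.2 (hy z.1 (E_stageModel.1 hz))
    · exact fun hy z hz =>
        E_stageModel.1 (hy ⟨z, h.inStage_of_mem y.2 hz⟩ (E_stageModel.2 hz))
  infinity := by
    obtain ⟨N, ⟨e, heN, he⟩, hN⟩ := h.infinity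
    obtain ⟨B, hB⟩ := h.separate InStage N
    obtain ⟨c, hc⟩ := h.exists_stageModel (B := B) fun y hy => ((hB y).1 hy).2
    have hes : InStage e := h.inStage_of_forall_mem fun y hy => (he y hy).elim
    refine ⟨c, ⟨⟨e, hes⟩, (hc _).2 ((hB e).2 ⟨heN, hes⟩), fun z hz => he z.1 (E_stageModel.1 hz)⟩,
      fun x hx => ?_⟩
    obtain ⟨hxN, hxs⟩ := (hB x.1).1 ((hc x).1 hx)
    obtain ⟨m, hmN, hm⟩ := hN x.1 hxN
    have hms : InStage m := h.inStage_of_forall_mem fun y hy => by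
      rcases (hm y).1 hy with h' | rfl
      exacts [h.inStage_of_mem hxs h', hxs]
    refine ⟨⟨m, hms⟩, (hc _).2 ((hB m).2 ⟨hmN, hms⟩), fun y => ?_⟩
    rw [E_stageModel, E_stageModel, hm]
    exact or_congr_right Subtype.ext_iff.symm
  sep P hP A := by
    have := Dfn.congr (Q := fun xs : Fin 1 → U => ∃ h : InStage (xs 0), P ⟨xs 0, h⟩)
      (h := stageInterp_yields.dfn hP) fun xs => by simp [Fin.forall_fin_one]
    obtain ⟨B, hB⟩ := h.separate (fun x => ∃ h : InStage x, P ⟨x, h⟩) A.1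
    obtain ⟨b, hb⟩ := h.exists_stageModel (B := B) fun x hx => ((hB x).1 hx).2.1
    refine ⟨b, fun y => ?_⟩
    rw [hb, hB, E_stageModel]
    exact and_congr_right fun _ => ⟨fun ⟨_, h⟩ => h, fun h => ⟨y.2, h⟩⟩
  repl R hR A hA := by
    have := Dfn.congr
      (Q := fun xs : Fin 2 → U => ∃ (h : InStage (xs 0)) (h' : InStage (xs 1)),
        R ⟨xs 0, h⟩ ⟨xs 1, h'⟩)
      (h := stageInterp_yields.dfn hR) fun xs => by
        constructor
        · rintro ⟨h, hr⟩; exact ⟨h 0, h 1, hr⟩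
        · rintro ⟨h, h', hr⟩; exact ⟨fun i => by fin_cases i <;> assumption, hr⟩
    obtain ⟨B, hB⟩ := h.replace
      (fun x y => ∃ (h : InStage x) (h' : InStage y), R ⟨x, h⟩ ⟨y, h'⟩) A.1 (by
        intro x hx
        have hxs := h.inStage_of_mem A.2 hx
        obtain ⟨k, hk⟩ := hA ⟨x, hxs⟩ (E_stageModel.2 hx)
        refine ⟨k.1, fun y => ⟨?_, ?_⟩⟩
        · rintro ⟨_, hy, hr⟩
          exact congrArg Subtype.val ((hk _).1 hr)
        · rintro rfl
          exact ⟨hxs, k.2, (hk _).2 rfl⟩)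
    obtain ⟨b, hb⟩ := h.exists_stageModel (B := B) fun y hy => by
      obtain ⟨_, _, _, h', _⟩ := (hB y).1 hy
      exact h'
    refine ⟨b, fun y => ?_⟩
    rw [hb, hB]
    constructor
    · rintro ⟨x, hx, hxs, _, hr⟩
      exact ⟨⟨x, hxs⟩, E_stageModel.2 hx, hr⟩
    · rintro ⟨x, hx, hr⟩
      exact ⟨x.1, E_stageModel.1 hx, x.2, y.2, hr⟩

theorem ZFModel.founded_stageModel (h : ZFModel U) : Founded (StageModel U) := by
  rintro A ⟨x, hx⟩
  obtain ⟨y, hy, hmin⟩ := h.exists_minimal A.2 (E_stageModel.1 hx)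
  exact ⟨⟨y, h.inStage_of_mem A.2 hy⟩, E_stageModel.2 hy,
    fun ⟨z, hz, hzy⟩ => hmin z.1 (E_stageModel.1 hz) (E_stageModel.1 hzy)⟩

theorem ZFModel.nonempty_stageModel (h : ZFModel U) : Nonempty (StageModel U) :=
  have ⟨e, he⟩ := h.exists_empty
  ⟨⟨e, h.inStage_of_forall_mem fun y hy => (he y hy).elim⟩⟩

end StageModel

/-- The two constructions are composed: `realize_tr` for `pureInterp` turns the translated
`inHierarchy` into membership in a stage within `PureSets M`. -/
theorem StarModel.hierarchyInterp_yields {M : Type} [LSet.Structure M] (hM : StarModel M) :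
    hierarchyInterp.Yields (δ := fun x : M => ∃ h : Pure x, InStage (toPure ⟨x, h⟩))
      (fun x => (⟨toPure ⟨x.1, x.2.1⟩, x.2.2⟩ : StageModel (PureSets M))) where
  dom x := by
    have h1 := hM.pureInterp_yields.dom x
    have h2 : ∀ h : Pure x, (pureInterp.tr inHierarchy).Realize (fun _ => x) default ↔
        InStage (toPure ⟨x, h⟩) := by
      intro h
      rw [← realize_inHierarchy]
      have := hM.pureInterp_yields.realize_tr inHierarchy (fun _ => ⟨x, h⟩) Fin.elim0
      unfold Formula.Realize
      convert this using 2
      rfl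
    change BoundedFormula.Realize (SetInterp.pure ⊓ pureInterp.tr inHierarchy) _ _ ↔ _
    rw [BoundedFormula.realize_inf]
    constructor
    · rintro ⟨h, h'⟩
      exact ⟨h1.1 h, (h2 _).1 h'⟩
    · rintro ⟨h, h'⟩
      exact ⟨h1.2 h, (h2 _).2 h'⟩
  eq x y := by
    rw [Subtype.ext_iff]
    exact hM.pureInterp_yields.eq ⟨x.1, x.2.1⟩ ⟨y.1, y.2.1⟩
  mem x y := by
    rw [E_stageModel]
    exact hM.pureInterp_yields.mem ⟨x.1, x.2.1⟩ ⟨y.1, y.2.1⟩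
  surj := by
    rintro ⟨y, hy⟩
    obtain ⟨x, rfl⟩ := toPure_surjective y
    exact ⟨⟨x.1, x.2, hy⟩, rfl⟩

theorem hierarchyInterp_interprets : hierarchyInterp.Interprets ZFStarNoExtNoFound ZF := by
  intro σ hσ M v xs
  have hM : StarModel M := .of_models M.is_model
  have := hM.zfModel.zfModel_stageModel.models hM.zfModel.founded_stageModel
  have := hM.zfModel.nonempty_stageModel
  rw [Subsingleton.elim v default, Subsingleton.elim xs default,
    hM.hierarchyInterp_yields.realize_sentence]
  exact hσ (Theory.ModelType.of ZF (StageModel (PureSets M))) default default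

end SetInterp

theorem mainTheorem1 :
    SetInterp.pureInterp.Interprets SetInterp.ZFStarNoExt SetInterp.ZF ∧
      SetInterp.hierarchyInterp.Interprets SetInterp.ZFStarNoExtNoFound SetInterp.ZF :=
  ⟨SetInterp.pureInterp_interprets, SetInterp.hierarchyInterp_interprets⟩
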